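/- **Setting.** Let $n\ge 1$, $T\ge 1$, $d\ge 0$ be integers. Let $f_1,\dots,f_n:\mathbb R^d\to\mathbb R$ be differentiable with $\|\nabla f_i(x)-\nabla f_i(y)\|\le L\|x-y\|$ for all $x,y$ and $i$ ($L>0$), and let $f=\frac1n\sum_{i=1}^n f_i$ be bounded from below, $f^*=\inf f$. Worker $i$ has stochastic gradients $\nabla f_i(x,\xi)$, $\xi\sim\mathcal D_i$, jointly measurable in $(x,\xi)$, that are unbiased and $\sigma$-sub-Gaussian ($\sigma\ge0$): for every $x\in\mathbb R^d$, $$\mathbb E[\nabla f_i(x,\xi)]=\nabla f_i(x),\qquad \mathbb E\exp\!\big(\|\nabla f_i(x,\xi)-\nabla f_i(x)\|^2/\sigma^2\big)\le e ,$$ where for $\sigma=0$ the second condition means $\nabla f_i(x,\xi)=\nabla f_i(x)$ almost surely. The samples $\xi_i^t\sim\mathcal D_i$ are independent over all workers $i$ and iterations $t$. For $\tau>0$ let $\mathrm{clip}_\tau(x)=\frac{\tau}{\|x\|}x$ if $\|x\|>\tau$ and $\mathrm{clip}_\tau(x)=x$ otherwise. Clip21-SGD2M without DP noise, with step size $\gamma>0$,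 momentum parameters $\beta,\hat\beta\in(0,1]$ and clipping level $\tau$, starts from $x^0\in\mathbb R^d$, $g^0=g_i^0=v_i^0=0$ and iterates $$x^{t+1}=x^t-\gamma g^t,\quad v_i^{t+1}=(1-\beta)v_i^t+\beta\nabla f_i(x^{t+1},\xi_i^{t+1}),\quad g_i^{t+1}=g_i^t+\hat\beta\,\mathrm{clip}_\tau(v_i^{t+1}-g_i^t),$$ $$g^{t+1}=g^t+\frac{\hat\beta}{n}\sum_{i=1}^n\mathrm{clip}_\tau(v_i^{t+1}-g_i^t).$$ **Theorem.** There is an absolute constant $k\in\mathbb N$, and for every $\hat\beta\in(0,1]$ (in particular for $\hat\beta=1$) a constant $C>0$ depending only on $\hat\beta$, such that the following holds. Let $\Delta>0$ satisfy $\Delta\ge f(x^0)-f^*$, let $B=\max_i\|\nabla f_i(x^0)\|$, $\tau>0$ and $\alpha\in(0,1)$. Then there are a step size $\gamma>0$ and a momentum parameter $\beta\in(0,1]$, depending only on $n,T,L,\Delta,B,\tau,\sigma,\alpha,\hat\beta$, such that with probability at least $1-\alpha$ the iterates of Clip21-SGD2M satisfy $$\frac1T\sum_{t=0}^{T-1}\|\nabla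 f(x^t)\|^2\le C\,\log^k\!\Big(\frac{12n(T+1)}{\alpha}\Big)\left(\frac{L\Delta(1+B/\tau)}{T}+\frac{\sigma(\sqrt{L\Delta}+B+\sigma)}{\sqrt{nT}}+\frac{L\Delta(\sqrt{L\Delta}+\sigma)}{\tau T}\right).$$ No bound on the gradients or on the heterogeneity of the $f_i$ is assumed. -/

import Mathlib

open MeasureTheory ProbabilityTheory

namespace Clip21

noncomputable section

/-- The space `ℝ^d` with its Euclidean norm. -/
abbrev E (d : ℕ) : Type := EuclideanSpace ℝ (Fin d)

/-- The average loss `f(x) = (1/n) ∑ᵢ fᵢ(x)`. -/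
def avgLoss {n d : ℕ} (f : Fin n → E d → ℝ) (x : E d) : ℝ :=
  (1 / (n : ℝ)) * ∑ i, f i x

/-- Every local loss is differentiable with an `L`-Lipschitz gradient, and the average loss is
bounded from below. -/
structure SmoothProblem {n d : ℕ} (L : ℝ) (f : Fin n → E d → ℝ) : Prop where
  differentiable : ∀ i, Differentiable ℝ (f i)
  smooth : ∀ i x y, ‖gradient (f i) x - gradient (f i) y‖ ≤ L * ‖x - y‖
  bddBelow : BddBelow (Set.range (avgLoss f))

/-- The stochastic gradient `G i x ξ` of worker `i`, where `ξ` has law `D i`, is an unbiased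
`σ`-sub-Gaussian estimator of `∇fᵢ(x)`: `E[exp(‖G i x ξ - ∇fᵢ(x)‖² / σ²)] ≤ exp 1`.
The last field says what this inequality means for `σ = 0`, with the conventions `0 / 0 = 0` and
`c / 0 = ∞` for `c > 0`. -/
structure SubGaussianOracle {n d : ℕ} {Ξ : Type*} [MeasurableSpace Ξ] (σ : ℝ)
    (f : Fin n → E d → ℝ) (D : Fin n → Measure Ξ) (G : Fin n → E d → Ξ → E d) : Prop where
  measurable : ∀ i, Measurable (fun p : E d × Ξ => G i p.1 p.2)
  integrable : ∀ i x, Integrable (G i x) (D i)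
  unbiased : ∀ i x, ∫ s, G i x s ∂(D i) = gradient (f i) x
  subGaussian : ∀ i x,
    ∫⁻ s, ENNReal.ofReal (Real.exp (‖G i x s - gradient (f i) x‖ ^ 2 / σ ^ 2)) ∂(D i)
      ≤ ENNReal.ofReal (Real.exp 1)
  noiseless : σ = 0 → ∀ i x, ∀ᵐ s ∂(D i), G i x s = gradient (f i) x

/-- The samples `ξ t i` (iteration `t`, worker `i`) are jointly independent over all iterations and
workers, and those of worker `i` have law `D i`. -/
structure IndepSamples {n : ℕ} {Ξ Ω : Type*} [MeasurableSpace Ξ] [MeasurableSpace Ω]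
    (P : Measure Ω) (D : Fin n → Measure Ξ) (ξ : ℕ → Fin n → Ω → Ξ) : Prop where
  measurable : ∀ t i, Measurable (ξ t i)
  law : ∀ t i, P.map (ξ t i) = D i
  indep : iIndepFun (fun p : ℕ × Fin n => ξ p.1 p.2) P

/-- The clipping operator. -/
def clip {d : ℕ} (τ : ℝ) (x : E d) : E d :=
  if τ < ‖x‖ then (τ / ‖x‖) • x else x

/-- The variables of Clip21-SGD2M: the iterate `x`, the server estimate `g`, and for each worker
the momentum `v i` and the local estimate `gl i`. -/
structure State (n d : ℕ) where
  x : E d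
  g : E d
  v : Fin n → E d
  gl : Fin n → E d

/-- One iteration of Clip21-SGD2M without DP noise (momentum parameters `β` and `β'`, step size
`γ`, clipping level `τ`), with the fresh sample `s i` at worker `i`. -/
def step {n d : ℕ} {Ξ : Type*} (γ β β' τ : ℝ) (G : Fin n → E d → Ξ → E d) (s : Fin n → Ξ)
    (S : State n d) : State n d :=
  let x' : E d := S.x - γ • S.g
  let v' : Fin n → E d := fun i => (1 - β) • S.v i + β • G i x' (s i)
  let c : Fin n → E d := fun i => clip τ (v' i - S.gl i)
  { x := x'
    g := S.g + (β' / (n : ℝ)) • ∑ i, c i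
    v := v'
    gl := fun i => S.gl i + β' • c i }

/-- The run of Clip21-SGD2M without DP noise from `x⁰` with `g⁰ = v⁰ = 0`; iteration
`t → t + 1` uses the samples `s (t + 1) i`. -/
def run {n d : ℕ} {Ξ : Type*} (γ β β' τ : ℝ) (G : Fin n → E d → Ξ → E d) (x0 : E d)
    (s : ℕ → Fin n → Ξ) : ℕ → State n d
  | 0 => { x := x0, g := 0, v := fun _ => 0, gl := fun _ => 0 }
  | t + 1 => step γ β β' τ G (s (t + 1)) (run γ β β' τ G x0 s t)

/-- The quantity `(1/T) ∑_{t<T} ‖∇f(xᵗ)‖²` along the run with samples `s`. -/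
def avgSqGrad {n d : ℕ} {Ξ : Type*} (f : Fin n → E d → ℝ) (γ β β' τ : ℝ)
    (G : Fin n → E d → Ξ → E d) (x0 : E d) (s : ℕ → Fin n → Ξ) (T : ℕ) : ℝ :=
  (1 / (T : ℝ)) *
    ∑ t ∈ Finset.range T, ‖gradient (avgLoss f) (run γ β β' τ G x0 s t).x‖ ^ 2

/-- The two displayed terms of the rate. -/
def mainRate (n T : ℕ) (L Δ B τ σ : ℝ) : ℝ :=
  L * Δ * (1 + B / τ) / T + σ * (Real.sqrt (L * Δ) + B + σ) / Real.sqrt (n * T)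

/-- The remaining term, which decreases like `1 / T`, faster than `1 / √T`. -/
def higherOrder (T : ℕ) (L Δ τ σ : ℝ) : ℝ :=
  L * Δ * (Real.sqrt (L * Δ) + σ) / (τ * T)

end

end Clip21

/-!
If no worker ever clips, the means of the local variables follow gradient descent along a doubly
averaged stochastic gradient: `g` averages the momentum with parameter `β'`, and the momentum
averages the gradients and the noise with parameter `β`. The tracking errors contract, so descent
bounds the energy `γ ∑ ‖gᵗ‖²` by a multiple of `Δ` plus the accumulated noise. The energy bounds
the drift of the gradient of each worker, whose momentum therefore moves by at most `β'τ` per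
iteration, while `vᵢ - gᵢ` shrinks to norm at most `(1 - β')τ` after each step without clipping.
Hence clipping stays inactive in the next iteration, and this induction closes without any bound
on the gradients. It uses the noise only through the norms of its moving averages, which are
sub-Gaussian: the bound `E[exp(‖S + X‖² / h)] ≤ exp((‖S‖² + s) / (h - s))`, for all shifts `S` and
all `h > s`, survives the addition of independent noise of the same kind, the parameters `s` adding
up.
-/

namespace Clip21

/-! ### Sub-Gaussian norms -/

section SubgaussianNorm

/-- The real exponential with values in `ℝ≥0∞`, for exponential moments stated as lower integrals,
so that no integrability condition is needed. -/
noncomputable def eexp (y : ℝ) : ENNReal := ENNReal.ofReal (Real.exp y)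

theorem eexp_zero : eexp 0 = 1 := by simp [eexp]

theorem eexp_ne_top (a : ℝ) : eexp a ≠ ⊤ := ENNReal.ofReal_ne_top

theorem eexp_mono : Monotone eexp := fun _ _ h =>
  ENNReal.ofReal_le_ofReal (Real.exp_le_exp.2 h)

theorem eexp_injective : Function.Injective eexp := fun _ _ h =>
  Real.exp_injective ((ENNReal.ofReal_eq_ofReal_iff (Real.exp_pos _).le (Real.exp_pos _).le).1 h)

theorem eexp_add (a b : ℝ) : eexp (a + b) = eexp a * eexp b := by
  rw [eexp, Real.exp_add, ENNReal.ofReal_mul (Real.exp_pos _).le]; rfl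

theorem eexp_rpow (a p : ℝ) : eexp a ^ p = eexp (p * a) := by
  rw [eexp, ENNReal.ofReal_rpow_of_pos (Real.exp_pos _), ← Real.exp_mul, mul_comm]; rfl

@[fun_prop]
theorem measurable_eexp : Measurable eexp := by
  unfold eexp; fun_prop

variable {Ω F : Type*} [MeasurableSpace Ω] {μ : Measure Ω}

theorem lintegral_eexp_add_le {φ ψ : Ω → ℝ} (hφ : AEMeasurable φ μ) (hψ : AEMeasurable ψ μ)
    {a b p q : ℝ} (hp : 0 ≤ p) (hq : 0 ≤ q) (hpq : p + q = 1)
    (ha : ∫⁻ ω, eexp (φ ω) ∂μ ≤ eexp a) (hb : ∫⁻ ω, eexp (ψ ω) ∂μ ≤ eexp b) :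
    ∫⁻ ω, eexp (p * φ ω + q * ψ ω) ∂μ ≤ eexp (p * a + q * b) := by
  calc ∫⁻ ω, eexp (p * φ ω + q * ψ ω) ∂μ = ∫⁻ ω, eexp (φ ω) ^ p * eexp (ψ ω) ^ q ∂μ := by
        simp only [eexp_rpow, eexp_add]
    _ ≤ (∫⁻ ω, eexp (φ ω) ∂μ) ^ p * (∫⁻ ω, eexp (ψ ω) ∂μ) ^ q :=
        ENNReal.lintegral_mul_norm_pow_le (measurable_eexp.comp_aemeasurable hφ)
          (measurable_eexp.comp_aemeasurable hψ) hp hq hpq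
    _ ≤ eexp a ^ p * eexp b ^ q := by gcongr
    _ = eexp (p * a + q * b) := by rw [eexp_rpow, eexp_rpow, eexp_add]

theorem lintegral_eexp_mul_le [IsProbabilityMeasure μ] {φ : Ω → ℝ} (hφ : AEMeasurable φ μ)
    {a p : ℝ} (hp : 0 ≤ p) (hp1 : p ≤ 1) (h : ∫⁻ ω, eexp (φ ω) ∂μ ≤ eexp a) :
    ∫⁻ ω, eexp (p * φ ω) ∂μ ≤ eexp (p * a) := by
  simpa using lintegral_eexp_add_le hφ aemeasurable_const hp (sub_nonneg.2 hp1)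
    (add_sub_cancel p 1) h (ψ := fun _ => 0) (b := 0) (by simp)

theorem exp_le_add_exp_sq (y : ℝ) : Real.exp y ≤ y + Real.exp (y ^ 2) := by
  have h1 := Real.add_one_le_exp (y ^ 2)
  rcases le_total |y| 1 with hy | hy
  · have h2 := (abs_le.1 (Real.abs_exp_sub_one_sub_id_le hy)).2
    linarith
  · rcases le_abs'.1 hy with hy | hy
    · have h2 : Real.exp y ≤ 1 := Real.exp_le_one_iff.2 (by linarith)
      nlinarith
    · have h2 : Real.exp y ≤ Real.exp (y ^ 2) := Real.exp_le_exp.2 (by nlinarith)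
      linarith

theorem lintegral_eexp_le_lintegral_eexp_sq {Y : Ω → ℝ} (hY : Integrable Y μ)
    (hmean : ∫ ω, Y ω ∂μ = 0) : ∫⁻ ω, eexp (Y ω) ∂μ ≤ ∫⁻ ω, eexp (Y ω ^ 2) ∂μ := by
  rcases eq_or_ne (∫⁻ ω, eexp (Y ω ^ 2) ∂μ) ⊤ with htop | htop
  · exact htop ▸ le_top
  have hYm : AEMeasurable Y μ := hY.aemeasurable
  have hsq : Integrable (fun ω => Real.exp (Y ω ^ 2)) μ :=
    ⟨(by fun_prop : AEMeasurable _ μ).aestronglyMeasurable,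
      (hasFiniteIntegral_iff_ofReal (.of_forall fun _ => (Real.exp_pos _).le)).2 htop.lt_top⟩
  have hexp : Integrable (fun ω => Real.exp (Y ω)) μ := by
    refine (hY.add hsq).mono' (by fun_prop : AEMeasurable _ μ).aestronglyMeasurable
      (.of_forall fun ω => ?_)
    rw [Real.norm_of_nonneg (Real.exp_pos _).le]
    exact exp_le_add_exp_sq _
  have hle : ∫ ω, Real.exp (Y ω) ∂μ ≤ ∫ ω, Real.exp (Y ω ^ 2) ∂μ :=
    calc ∫ ω, Real.exp (Y ω) ∂μ ≤ ∫ ω, (Y ω + Real.exp (Y ω ^ 2)) ∂μ :=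
          integral_mono hexp (hY.add hsq) fun ω => exp_le_add_exp_sq _
      _ = ∫ ω, Real.exp (Y ω ^ 2) ∂μ := by rw [integral_add hY hsq, hmean, zero_add]
  unfold eexp
  rw [← ofReal_integral_eq_lintegral_ofReal hexp (.of_forall fun _ => (Real.exp_pos _).le),
    ← ofReal_integral_eq_lintegral_ofReal hsq (.of_forall fun _ => (Real.exp_pos _).le)]
  exact ENNReal.ofReal_le_ofReal hle

variable [NormedAddCommGroup F]

section Centered

variable [InnerProductSpace ℝ F] [IsProbabilityMeasure μ] {X : Ω → F} {σ : ℝ}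

theorem lintegral_eexp_inner_le_of_le_one [CompleteSpace F] (hX : Integrable X μ)
    (hmean : ∫ ω, X ω ∂μ = 0) (hσ : 0 < σ) (h : ∫⁻ ω, eexp (‖X ω‖ ^ 2 / σ ^ 2) ∂μ ≤ eexp 1)
    {u : F} (hu : ‖u‖ ^ 2 * σ ^ 2 ≤ 1) :
    ∫⁻ ω, eexp (inner ℝ u (X ω)) ∂μ ≤ eexp (‖u‖ ^ 2 * σ ^ 2) := by
  have hsq : ∀ ω, inner ℝ u (X ω) ^ 2 ≤ ‖u‖ ^ 2 * σ ^ 2 * (‖X ω‖ ^ 2 / σ ^ 2) := fun ω => by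
    have hCS : |inner ℝ u (X ω)| ≤ ‖u‖ * ‖X ω‖ := abs_real_inner_le_norm u (X ω)
    calc inner ℝ u (X ω) ^ 2 = |inner ℝ u (X ω)| ^ 2 := (sq_abs _).symm
      _ ≤ (‖u‖ * ‖X ω‖) ^ 2 := by gcongr
      _ = ‖u‖ ^ 2 * σ ^ 2 * (‖X ω‖ ^ 2 / σ ^ 2) := by field_simp
  calc ∫⁻ ω, eexp (inner ℝ u (X ω)) ∂μ ≤ ∫⁻ ω, eexp (inner ℝ u (X ω) ^ 2) ∂μ :=
        lintegral_eexp_le_lintegral_eexp_sq (hX.const_inner u)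
          (by rw [integral_inner hX, hmean, inner_zero_right])
    _ ≤ ∫⁻ ω, eexp (‖u‖ ^ 2 * σ ^ 2 * (‖X ω‖ ^ 2 / σ ^ 2)) ∂μ :=
        lintegral_mono fun ω => eexp_mono (hsq ω)
    _ ≤ eexp (‖u‖ ^ 2 * σ ^ 2 * 1) :=
        lintegral_eexp_mul_le ((hX.1.norm.aemeasurable.pow_const 2).div_const _)
          (by positivity) hu h
    _ = eexp (‖u‖ ^ 2 * σ ^ 2) := by rw [mul_one]

theorem lintegral_eexp_inner_le_of_one_le (hX : AEStronglyMeasurable X μ) (hσ : 0 < σ)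
    (h : ∫⁻ ω, eexp (‖X ω‖ ^ 2 / σ ^ 2) ∂μ ≤ eexp 1) {u : F} (hu : 1 ≤ ‖u‖ ^ 2 * σ ^ 2) :
    ∫⁻ ω, eexp (inner ℝ u (X ω)) ∂μ ≤ eexp (‖u‖ ^ 2 * σ ^ 2) := by
  have hYoung : ∀ ω,
      inner ℝ u (X ω) ≤ 1 / 2 * (‖X ω‖ ^ 2 / σ ^ 2) + 1 / 2 * (‖u‖ ^ 2 * σ ^ 2) := fun ω => by
    have hsq : 1 / 2 * (‖X ω‖ ^ 2 / σ ^ 2) + 1 / 2 * (‖u‖ ^ 2 * σ ^ 2)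
        = ‖u‖ * ‖X ω‖ + (‖u‖ * σ - ‖X ω‖ / σ) ^ 2 / 2 := by
      field_simp
      ring
    have : 0 ≤ (‖u‖ * σ - ‖X ω‖ / σ) ^ 2 / 2 := by positivity
    linarith [real_inner_le_norm u (X ω)]
  calc ∫⁻ ω, eexp (inner ℝ u (X ω)) ∂μ
      ≤ ∫⁻ ω, eexp (1 / 2 * (‖X ω‖ ^ 2 / σ ^ 2) + 1 / 2 * (‖u‖ ^ 2 * σ ^ 2)) ∂μ :=
        lintegral_mono fun ω => eexp_mono (hYoung ω)
    _ ≤ eexp (1 / 2 * 1 + 1 / 2 * (‖u‖ ^ 2 * σ ^ 2)) :=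
        lintegral_eexp_add_le ((hX.norm.aemeasurable.pow_const 2).div_const _) aemeasurable_const
          (by norm_num) (by norm_num) (by norm_num) h (by simp)
    _ ≤ eexp (‖u‖ ^ 2 * σ ^ 2) := eexp_mono (by linarith)

theorem lintegral_eexp_inner_le [CompleteSpace F] (hX : Integrable X μ)
    (hmean : ∫ ω, X ω ∂μ = 0) (hσ : 0 < σ) (h : ∫⁻ ω, eexp (‖X ω‖ ^ 2 / σ ^ 2) ∂μ ≤ eexp 1)
    (u : F) : ∫⁻ ω, eexp (inner ℝ u (X ω)) ∂μ ≤ eexp (‖u‖ ^ 2 * σ ^ 2) :=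
  (le_total (‖u‖ ^ 2 * σ ^ 2) 1).elim (lintegral_eexp_inner_le_of_le_one hX hmean hσ h)
    (lintegral_eexp_inner_le_of_one_le hX.1 hσ h)

end Centered

/-- `X` has sub-Gaussian norm with variance proxy `s`: every translate of `X` has the exponential
square moments of a translated Gaussian vector of total variance `s`, up to constants. Quantifying
over the translation `S` makes the proxies of independent vectors add up, without a factor depending
on the dimension. -/
def HasSubgaussianNorm (X : Ω → F) (s : ℝ) (μ : Measure Ω) : Prop :=
  ∀ (S : F) (h : ℝ), s < h → ∫⁻ ω, eexp (‖S + X ω‖ ^ 2 / h) ∂μ ≤ eexp ((‖S‖ ^ 2 + s) / (h - s))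

theorem div_add_div_sq_add_div_le {a s h : ℝ} (ha : 0 ≤ a) (hs : 0 ≤ s) (hh : s < h) :
    a / h + a * s / h ^ 2 + s / h ≤ (a + s) / (h - s) := by
  have h0 : 0 < h := by linarith
  rw [le_div_iff₀ (sub_pos.2 hh)]
  have hmul : (a / h + a * s / h ^ 2 + s / h) * (h - s)
      = a + s - a * s ^ 2 / h ^ 2 - s ^ 2 / h := by
    field_simp
    ring
  have : 0 ≤ a * s ^ 2 / h ^ 2 := by positivity
  have : 0 ≤ s ^ 2 / h := by positivity
  linarith

theorem hasSubgaussianNorm_of_lintegral_le [InnerProductSpace ℝ F] [CompleteSpace F]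
    [IsProbabilityMeasure μ] {X : Ω → F} (hX : Integrable X μ) (hmean : ∫ ω, X ω ∂μ = 0) {σ : ℝ}
    (hσ : 0 < σ) (h : ∫⁻ ω, eexp (‖X ω‖ ^ 2 / σ ^ 2) ∂μ ≤ eexp 1) :
    HasSubgaussianNorm X (8 * σ ^ 2) μ := by
  intro S k hk
  have hk0 : 0 < k := by nlinarith [sq_nonneg σ]
  have hinner := lintegral_eexp_inner_le hX hmean hσ h ((4 / k) • S)
  have hnorm : ∫⁻ ω, eexp (2 * σ ^ 2 / k * (‖X ω‖ ^ 2 / σ ^ 2)) ∂μ ≤ eexp (2 * σ ^ 2 / k * 1) :=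
    lintegral_eexp_mul_le ((hX.1.norm.aemeasurable.pow_const 2).div_const _) (by positivity)
      (by rw [div_le_one hk0]; nlinarith) h
  have hexpand : ∀ ω, ‖S + X ω‖ ^ 2 / k = ‖S‖ ^ 2 / k + (1 / 2 * inner ℝ ((4 / k) • S) (X ω)
      + 1 / 2 * (2 * σ ^ 2 / k * (‖X ω‖ ^ 2 / σ ^ 2))) := fun ω => by
    rw [norm_add_sq_real, real_inner_smul_left]
    field_simp
    ring
  simp only [hexpand, eexp_add (‖S‖ ^ 2 / k)]
  rw [lintegral_const_mul' _ _ (eexp_ne_top _)]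
  calc eexp (‖S‖ ^ 2 / k) * _ ≤ eexp (‖S‖ ^ 2 / k)
          * eexp (1 / 2 * (‖(4 / k) • S‖ ^ 2 * σ ^ 2) + 1 / 2 * (2 * σ ^ 2 / k * 1)) := by
        gcongr
        exact lintegral_eexp_add_le (hX.const_inner _).aemeasurable
          (((hX.1.norm.aemeasurable.pow_const 2).div_const _).const_mul _)
          (by norm_num) (by norm_num) (by norm_num) hinner hnorm
    _ = eexp (‖S‖ ^ 2 / k + ‖S‖ ^ 2 * (8 * σ ^ 2) / k ^ 2 + σ ^ 2 / k) := by
        rw [← eexp_add, norm_smul, Real.norm_of_nonneg (by positivity)]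
        congr 1
        field_simp
        ring
    _ ≤ eexp ((‖S‖ ^ 2 + 8 * σ ^ 2) / (k - 8 * σ ^ 2)) := by
        refine eexp_mono
          (le_trans ?_ (div_add_div_sq_add_div_le (sq_nonneg ‖S‖) (by positivity) hk))
        gcongr
        nlinarith [sq_nonneg σ]

theorem hasSubgaussianNorm_map_iff [MeasurableSpace F] [BorelSpace F] [SecondCountableTopology F]
    {Z : Type*} [MeasurableSpace Z] {X : Z → F} (hX : Measurable X) {ζ : Ω → Z}
    (hζ : Measurable ζ) {s : ℝ} :
    HasSubgaussianNorm X s (μ.map ζ) ↔ HasSubgaussianNorm (fun ω => X (ζ ω)) s μ := by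
  refine forall₃_congr fun S h _ => ?_
  rw [lintegral_map (by fun_prop) hζ]

theorem hasSubgaussianNorm_zero_of_ae_eq_zero [IsProbabilityMeasure μ] {X : Ω → F}
    (h : X =ᵐ[μ] 0) : HasSubgaussianNorm X 0 μ := by
  intro S k _
  have : ∫⁻ ω, eexp (‖S + X ω‖ ^ 2 / k) ∂μ = ∫⁻ _, eexp (‖S‖ ^ 2 / k) ∂μ :=
    lintegral_congr_ae <| h.mono fun ω hω => by simp only [hω, Pi.zero_apply, add_zero]
  simp [this]

theorem div_sub_add_div_sub_le {a s r h : ℝ} (hs : 0 ≤ s) (hr : 0 ≤ r) (hh : r + s < h) :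
    (a + r) / (h - s - r) + s / (h - s) ≤ (a + (r + s)) / (h - (r + s)) := by
  have : 0 < h - (r + s) := sub_pos.2 hh
  calc (a + r) / (h - s - r) + s / (h - s)
      ≤ (a + r) / (h - (r + s)) + s / (h - (r + s)) := by
        rw [sub_sub, add_comm s r]
        gcongr
        linarith
    _ = (a + (r + s)) / (h - (r + s)) := by rw [← add_div, add_assoc]

namespace HasSubgaussianNorm

variable {X : Ω → F} {s r : ℝ}

theorem nonneg [IsProbabilityMeasure μ] (hX : HasSubgaussianNorm X s μ) : 0 ≤ s := by
  by_contra! hs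
  have hmoment : (1 : ENNReal) ≤ eexp (s / (1 - s)) :=
    calc (1 : ENNReal) = ∫⁻ _, eexp 0 ∂μ := by simp [eexp_zero]
      _ ≤ ∫⁻ ω, eexp (‖0 + X ω‖ ^ 2 / 1) ∂μ := lintegral_mono fun ω => eexp_mono (by positivity)
      _ ≤ eexp ((‖(0 : F)‖ ^ 2 + s) / (1 - s)) := hX 0 1 (by linarith)
      _ = eexp (s / (1 - s)) := by simp
  have hneg : s / (1 - s) < 0 := div_neg_of_neg_of_pos hs (by linarith)
  rw [eexp, ENNReal.one_le_ofReal, Real.one_le_exp_iff] at hmoment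
  exact hmoment.not_gt hneg

theorem mono [IsProbabilityMeasure μ] (hX : HasSubgaussianNorm X s μ) (hsr : s ≤ r) :
    HasSubgaussianNorm X r μ := by
  intro S h hh
  have hs := hX.nonneg
  have hr : 0 ≤ ‖S‖ ^ 2 + r := add_nonneg (sq_nonneg _) (hs.trans hsr)
  have : 0 < h - r := sub_pos.2 hh
  refine (hX S h (by linarith)).trans (eexp_mono ?_)
  gcongr

theorem smul [NormedSpace ℝ F] [IsProbabilityMeasure μ] (hX : HasSubgaussianNorm X s μ) (a : ℝ) :
    HasSubgaussianNorm (fun ω => a • X ω) (a ^ 2 * s) μ := by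
  intro S h hh
  rcases eq_or_ne a 0 with rfl | ha
  · simp
  have hlt : s < h / a ^ 2 := by rw [lt_div_iff₀ (by positivity)]; linarith
  have hscale : ∀ ω, ‖S + a • X ω‖ ^ 2 / h = ‖a⁻¹ • S + X ω‖ ^ 2 / (h / a ^ 2) := fun ω => by
    rw [← smul_inv_smul₀ ha S, ← smul_add, inv_smul_smul₀ ha, norm_smul, mul_pow,
      Real.norm_eq_abs, sq_abs]
    field_simp
  have hbound : (‖S‖ ^ 2 + a ^ 2 * s) / (h - a ^ 2 * s)
      = (‖a⁻¹ • S‖ ^ 2 + s) / (h / a ^ 2 - s) := by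
    rw [norm_smul, mul_pow, Real.norm_eq_abs, sq_abs, div_eq_div_iff (by linarith) (by linarith)]
    field_simp
  simpa only [hscale, hbound] using hX (a⁻¹ • S) (h / a ^ 2) hlt

theorem ae_eq_zero [IsProbabilityMeasure μ] (hX : HasSubgaussianNorm X 0 μ)
    (hXm : AEStronglyMeasurable X μ) : X =ᵐ[μ] 0 := by
  have hint : ∫⁻ ω, eexp (‖X ω‖ ^ 2) ∂μ ≤ 1 := by
    simpa [eexp_zero] using hX 0 1 one_pos
  have hone : (fun _ => (1 : ENNReal)) =ᵐ[μ] fun ω => eexp (‖X ω‖ ^ 2) :=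
    ae_eq_of_ae_le_of_lintegral_le
      (.of_forall fun ω => eexp_zero.symm.trans_le (eexp_mono (by positivity))) (by simp)
      (measurable_eexp.comp_aemeasurable (hXm.norm.aemeasurable.pow_const 2)) (by simpa using hint)
  filter_upwards [hone] with ω hω
  simpa using eexp_injective (hω.symm.trans eexp_zero.symm)

theorem measure_lt_norm_sq_le [IsProbabilityMeasure μ] (hX : HasSubgaussianNorm X s μ)
    (hXm : AEStronglyMeasurable X μ) (r : ℝ) :
    μ {ω | 2 * s * r < ‖X ω‖ ^ 2} ≤ eexp (1 - r) := by
  rcases hX.nonneg.eq_or_lt with rfl | hs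
  · have hnull : μ {ω | 2 * 0 * r < ‖X ω‖ ^ 2} = 0 :=
      measure_mono_null (fun ω hω => by simpa [sq_pos_iff] using hω) (hX.ae_eq_zero hXm)
    exact hnull ▸ zero_le
  have hmoment : ∫⁻ ω, eexp (‖X ω‖ ^ 2 / (2 * s)) ∂μ ≤ eexp 1 := by
    have h := hX 0 (2 * s) (by linarith)
    have hone : s / (2 * s - s) = 1 := by
      rw [two_mul, add_sub_cancel_right, div_self hs.ne']
    simpa only [zero_add, norm_zero, zero_pow two_ne_zero, hone] using h
  calc μ {ω | 2 * s * r < ‖X ω‖ ^ 2}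
      ≤ μ {ω | eexp r ≤ eexp (‖X ω‖ ^ 2 / (2 * s))} :=
        measure_mono fun ω hω => eexp_mono <| by
          rw [le_div_iff₀ (by positivity), mul_comm]
          exact le_of_lt hω
    _ = eexp (-r) * (eexp r * μ {ω | eexp r ≤ eexp (‖X ω‖ ^ 2 / (2 * s))}) := by
        rw [← mul_assoc, ← eexp_add, neg_add_cancel, eexp_zero, one_mul]
    _ ≤ eexp (-r) * eexp 1 := by
        gcongr
        exact (mul_meas_ge_le_lintegral₀ (measurable_eexp.comp_aemeasurable
          ((hXm.norm.aemeasurable.pow_const 2).div_const _)) _).trans hmoment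
    _ = eexp (1 - r) := by rw [← eexp_add, neg_add_eq_sub]

variable [MeasurableSpace F] [BorelSpace F] [SecondCountableTopology F] [IsProbabilityMeasure μ]

section FreshSample

variable {Y Z : Type*} [MeasurableSpace Y] [MeasurableSpace Z] {H : Ω → Y} {ζ : Ω → Z}
  {S : Y → F} {X : Y → Z → F}

theorem lintegral_eexp_add_le_of_indepFun (hH : Measurable H) (hζ : Measurable ζ)
    (hind : IndepFun H ζ μ) (hS : Measurable S) (hXm : Measurable fun p : Y × Z => X p.1 p.2)
    (hX : ∀ y, HasSubgaussianNorm (X y) s (μ.map ζ)) {h : ℝ} (hh : s < h) :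
    ∫⁻ ω, eexp (‖S (H ω) + X (H ω) (ζ ω)‖ ^ 2 / h) ∂μ
      ≤ ∫⁻ ω, eexp ((‖S (H ω)‖ ^ 2 + s) / (h - s)) ∂μ := by
  have hm : Measurable fun p : Y × Z => eexp (‖S p.1 + X p.1 p.2‖ ^ 2 / h) := by fun_prop
  have := Measure.isProbabilityMeasure_map (μ := μ) hζ.aemeasurable
  calc ∫⁻ ω, eexp (‖S (H ω) + X (H ω) (ζ ω)‖ ^ 2 / h) ∂μ
      = ∫⁻ p, eexp (‖S p.1 + X p.1 p.2‖ ^ 2 / h) ∂(μ.map fun ω => (H ω, ζ ω)) :=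
        (lintegral_map hm (hH.prodMk hζ)).symm
    _ = ∫⁻ y, ∫⁻ z, eexp (‖S y + X y z‖ ^ 2 / h) ∂(μ.map ζ) ∂(μ.map H) := by
        rw [(indepFun_iff_map_prod_eq_prod_map_map hH.aemeasurable hζ.aemeasurable).1 hind,
          lintegral_prod _ hm.aemeasurable]
    _ ≤ ∫⁻ y, eexp ((‖S y‖ ^ 2 + s) / (h - s)) ∂(μ.map H) :=
        lintegral_mono fun y => hX y (S y) h hh
    _ = ∫⁻ ω, eexp ((‖S (H ω)‖ ^ 2 + s) / (h - s)) ∂μ := lintegral_map (by fun_prop) hH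

theorem add_fresh (hH : Measurable H) (hζ : Measurable ζ) (hind : IndepFun H ζ μ)
    (hS : HasSubgaussianNorm (fun ω => S (H ω)) r μ) (hSm : Measurable S)
    (hX : ∀ y, HasSubgaussianNorm (X y) s (μ.map ζ))
    (hXm : Measurable fun p : Y × Z => X p.1 p.2) :
    HasSubgaussianNorm (fun ω => S (H ω) + X (H ω) (ζ ω)) (r + s) μ := by
  intro x h hh
  have hr := hS.nonneg
  have := Measure.isProbabilityMeasure_map (μ := μ) hζ.aemeasurable
  obtain ⟨ω₀⟩ := μ.nonempty_of_neZero
  have hs := (hX (H ω₀)).nonneg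
  calc ∫⁻ ω, eexp (‖x + (S (H ω) + X (H ω) (ζ ω))‖ ^ 2 / h) ∂μ
      ≤ ∫⁻ ω, eexp ((‖x + S (H ω)‖ ^ 2 + s) / (h - s)) ∂μ := by
        simp only [← add_assoc]
        exact lintegral_eexp_add_le_of_indepFun (S := fun y => x + S y) hH hζ hind
          (by fun_prop) hXm hX (by linarith)
    _ = (∫⁻ ω, eexp (‖x + S (H ω)‖ ^ 2 / (h - s)) ∂μ) * eexp (s / (h - s)) := by
        simp only [add_div, eexp_add]
        exact lintegral_mul_const' _ _ (eexp_ne_top _)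
    _ ≤ eexp ((‖x‖ ^ 2 + r) / (h - s - r)) * eexp (s / (h - s)) := by
        gcongr
        exact hS x (h - s) (by linarith)
    _ ≤ eexp ((‖x‖ ^ 2 + (r + s)) / (h - (r + s))) := by
        rw [← eexp_add]
        exact eexp_mono (div_sub_add_div_sub_le hs hr hh)

theorem convexComb_fresh [NormedSpace ℝ F] {b : ℝ} (hb : 0 ≤ b) (hb1 : b ≤ 1)
    (hH : Measurable H) (hζ : Measurable ζ) (hind : IndepFun H ζ μ)
    (hS : HasSubgaussianNorm (fun ω => S (H ω)) (b * s) μ) (hSm : Measurable S)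
    (hX : ∀ y, HasSubgaussianNorm (X y) s (μ.map ζ))
    (hXm : Measurable fun p : Y × Z => X p.1 p.2) :
    HasSubgaussianNorm (fun ω => (1 - b) • S (H ω) + b • X (H ω) (ζ ω)) (b * s) μ := by
  have := Measure.isProbabilityMeasure_map (μ := μ) hζ.aemeasurable
  have hbs := hS.nonneg
  refine (add_fresh (S := fun y => (1 - b) • S y) (X := fun y z => b • X y z) hH hζ hind
    (hS.smul (1 - b)) (by fun_prop) (fun y => (hX y).smul b) (by fun_prop)).mono ?_
  nlinarith [mul_nonneg (mul_nonneg hb hbs) (sub_nonneg.2 hb1)]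

end FreshSample

theorem add {X Y : Ω → F} (hX : HasSubgaussianNorm X s μ) (hXm : Measurable X)
    (hY : HasSubgaussianNorm Y r μ) (hYm : Measurable Y) (hind : IndepFun X Y μ) :
    HasSubgaussianNorm (fun ω => X ω + Y ω) (s + r) μ := by
  exact add_fresh (S := fun x => x) (X := fun _ y => y) hXm hYm hind hX measurable_id
    (fun _ => (hasSubgaussianNorm_map_iff measurable_id hYm).2 hY) measurable_snd

theorem sum {ι : Type*} {X : ι → Ω → F} {s : ι → ℝ} (hX : ∀ i, HasSubgaussianNorm (X i) (s i) μ)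
    (hXm : ∀ i, Measurable (X i)) (hind : iIndepFun X μ) (I : Finset ι) :
    HasSubgaussianNorm (fun ω => ∑ i ∈ I, X i ω) (∑ i ∈ I, s i) μ := by
  classical
  induction I using Finset.induction_on with
  | empty => exact hasSubgaussianNorm_zero_of_ae_eq_zero (.of_forall fun _ => by simp)
  | insert i I hi ih =>
    have hindI : IndepFun (fun ω => ∑ j ∈ I, X j ω) (X i) μ := by
      simpa only [Finset.sum_fn] using hind.indepFun_finsetSum_of_notMem hXm hi
    simp only [Finset.sum_insert hi]
    exact (hX i).add (hXm i) ih (by fun_prop) hindI.symm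

theorem sum_pi {ι Z : Type*} [Fintype ι] [MeasurableSpace Z] {D : ι → Measure Z}
    [∀ i, IsProbabilityMeasure (D i)] {X : ι → Z → F} {s : ι → ℝ}
    (hX : ∀ i, HasSubgaussianNorm (X i) (s i) (D i)) (hXm : ∀ i, Measurable (X i)) :
    HasSubgaussianNorm (fun z : ι → Z => ∑ i, X i (z i)) (∑ i, s i) (Measure.pi D) := by
  refine sum (X := fun i (z : ι → Z) => X i (z i)) (fun i => ?_) (fun i => by fun_prop)
    (iIndepFun_pi fun i => (hXm i).aemeasurable) Finset.univ
  rw [← hasSubgaussianNorm_map_iff (hXm i) (measurable_pi_apply i),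
    (measurePreserving_eval D i).map_eq]
  exact hX i

end HasSubgaussianNorm

end SubgaussianNorm

/-! ### Exponential moving averages -/

section MovingAvg

/-- The exponential moving average, with parameter `b` and initial value `0`, of a sequence `y`.
The term `y 0` does not enter. -/
noncomputable def movingAvg {F : Type*} [AddCommGroup F] [Module ℝ F] (b : ℝ) (y : ℕ → F) : ℕ → F
  | 0 => 0
  | t + 1 => (1 - b) • movingAvg b y t + b • y (t + 1)

variable {F Ω : Type*} [NormedAddCommGroup F] [NormedSpace ℝ F] [MeasurableSpace F] [BorelSpace F]
  [SecondCountableTopology F] [MeasurableSpace Ω]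

theorem measurable_movingAvg {b : ℝ} {y : ℕ → Ω → F} {t : ℕ} (hy : ∀ r ≤ t, Measurable (y r)) :
    Measurable fun ω => movingAvg b (fun r => y r ω) t := by
  induction t with
  | zero => exact measurable_const
  | succ t ih =>
    exact ((ih fun r hr => hy r (hr.trans t.le_succ)).const_smul (1 - b)).add
      ((hy (t + 1) le_rfl).const_smul b)

theorem hasSubgaussianNorm_movingAvg {Y Z : Type*} [MeasurableSpace Y] [MeasurableSpace Z]
    {μ : Measure Ω} [IsProbabilityMeasure μ] {H : ℕ → Ω → Y} {ζ : ℕ → Ω → Z} {X : Y → Z → F}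
    {b s : ℝ} (hb : 0 ≤ b) (hb1 : b ≤ 1) (hH : ∀ t, Measurable (H t)) (hζ : ∀ t, Measurable (ζ t))
    (hind : ∀ t, IndepFun (fun ω => (movingAvg b (fun r => X (H r ω) (ζ r ω)) t, H (t + 1) ω))
      (ζ (t + 1)) μ)
    (hX : ∀ t y, HasSubgaussianNorm (X y) s (μ.map (ζ t)))
    (hXm : Measurable fun p : Y × Z => X p.1 p.2) (t : ℕ) :
    HasSubgaussianNorm (fun ω => movingAvg b (fun r => X (H r ω) (ζ r ω)) t) (b * s) μ := by
  induction t with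
  | zero =>
    obtain ⟨ω₀⟩ := μ.nonempty_of_neZero
    have := Measure.isProbabilityMeasure_map (μ := μ) (hζ 0).aemeasurable
    exact (hasSubgaussianNorm_zero_of_ae_eq_zero (.of_forall fun _ => rfl)).mono
      (mul_nonneg hb (hX 0 (H 0 ω₀)).nonneg)
  | succ t ih =>
    have hM : Measurable fun ω => movingAvg b (fun r => X (H r ω) (ζ r ω)) t :=
      measurable_movingAvg fun r _ => hXm.comp ((hH r).prodMk (hζ r))
    have hXm' : Measurable fun p : (F × Y) × Z => X p.1.2 p.2 :=
      hXm.comp ((measurable_snd.comp measurable_fst).prodMk measurable_snd)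
    exact HasSubgaussianNorm.convexComb_fresh (S := fun p : F × Y => p.1)
      (X := fun (p : F × Y) z => X p.2 z) (ζ := ζ (t + 1))
      (H := fun ω => (movingAvg b (fun r => X (H r ω) (ζ r ω)) t, H (t + 1) ω))
      hb hb1 (hM.prodMk (hH (t + 1))) (hζ (t + 1)) (hind t) ih
      measurable_fst (fun p => hX (t + 1) p.2) hXm'

end MovingAvg

/-! ### Smooth functions -/

section Mean

variable {n : ℕ}

/-- The average `(1/n) ∑ᵢ yᵢ` of one vector per worker; it is `0` if there is no worker. -/
noncomputable def mean {F : Type*} [AddCommGroup F] [Module ℝ F] (y : Fin n → F) : F :=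
  (1 / (n : ℝ)) • ∑ i, y i

theorem norm_mean_le {F : Type*} [NormedAddCommGroup F] [NormedSpace ℝ F] {y : Fin n → F} {c : ℝ}
    (hc : 0 ≤ c) (h : ∀ i, ‖y i‖ ≤ c) : ‖mean y‖ ≤ c := by
  have hsum : ‖∑ i, y i‖ ≤ n * c := (norm_sum_le _ _).trans <| by
    simpa using Finset.sum_le_sum (s := Finset.univ) fun i _ => h i
  calc ‖mean y‖ = 1 / (n : ℝ) * ‖∑ i, y i‖ := by
        rw [mean, norm_smul, Real.norm_of_nonneg (by positivity)]
    _ ≤ 1 / (n : ℝ) * (n * c) := by gcongr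
    _ = (n : ℝ)⁻¹ * n * c := by ring
    _ ≤ c := mul_le_of_le_one_left hc inv_mul_le_one

end Mean

section Smooth

variable {F : Type*} [NormedAddCommGroup F] [InnerProductSpace ℝ F] [CompleteSpace F]

/-- `φ` is `L`-smooth: it is differentiable and its gradient is `L`-Lipschitz. -/
structure SmoothWith (L : ℝ) (φ : F → ℝ) : Prop where
  differentiable : Differentiable ℝ φ
  norm_gradient_sub_le : ∀ x y, ‖gradient φ x - gradient φ y‖ ≤ L * ‖x - y‖

namespace SmoothWith

variable {L γ : ℝ} {φ : F → ℝ}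

theorem measurable_gradient [MeasurableSpace F] [BorelSpace F] (hφ : SmoothWith L φ) :
    Measurable (gradient φ) :=
  (LipschitzWith.of_dist_le_mul (K := L.toNNReal) fun x y => by
    rw [dist_eq_norm, dist_eq_norm]
    refine (hφ.norm_gradient_sub_le x y).trans ?_
    gcongr
    exact Real.le_coe_toNNReal L).continuous.measurable

theorem norm_gradient_sub_step_sq_le (hφ : SmoothWith L φ) (γ : ℝ) (x g : F) :
    ‖gradient φ x - gradient φ (x - γ • g)‖ ^ 2 ≤ (L * γ) ^ 2 * ‖g‖ ^ 2 := by
  calc ‖gradient φ x - gradient φ (x - γ • g)‖ ^ 2 ≤ (L * ‖x - (x - γ • g)‖) ^ 2 := by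
        gcongr
        exact hφ.norm_gradient_sub_le _ _
    _ = (L * γ) ^ 2 * ‖g‖ ^ 2 := by
        rw [sub_sub_cancel, norm_smul, mul_pow, mul_pow, mul_pow, Real.norm_eq_abs, sq_abs,
          mul_assoc]

theorem le_quadratic (hφ : SmoothWith L φ) (x h : F) :
    φ (x + h) ≤ φ x + inner ℝ (gradient φ x) h + L / 2 * ‖h‖ ^ 2 := by
  let ψ : ℝ → ℝ := fun s => φ (x + s • h) - s * inner ℝ (gradient φ x) h - L / 2 * ‖h‖ ^ 2 * s ^ 2
  have hψ : ∀ s, HasDerivAt ψ (inner ℝ (gradient φ (x + s • h) - gradient φ x) h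
      - L / 2 * ‖h‖ ^ 2 * (2 * s)) s := fun s => by
    have hline : HasDerivAt (fun s : ℝ => x + s • h) h s := by
      simpa using ((hasDerivAt_id s).smul_const h).const_add x
    have hcomp :=
      (hφ.differentiable (x + s • h)).hasGradientAt.hasFDerivAt.comp_hasDerivAt s hline
    refine ((hcomp.sub ((hasDerivAt_id s).mul_const (inner ℝ (gradient φ x) h))).sub
      (((hasDerivAt_id s).pow 2).const_mul (L / 2 * ‖h‖ ^ 2))).congr_deriv ?_
    simp [inner_sub_left]
  have hanti : AntitoneOn ψ (Set.Icc 0 1) := by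
    refine antitoneOn_of_deriv_nonpos (convex_Icc 0 1)
      (fun s _ => (hψ s).continuousAt.continuousWithinAt)
      (fun s _ => (hψ s).differentiableAt.differentiableWithinAt) fun s hs => ?_
    rw [interior_Icc] at hs
    have hinner : inner ℝ (gradient φ (x + s • h) - gradient φ x) h ≤ L * ‖s • h‖ * ‖h‖ :=
      (real_inner_le_norm _ _).trans <| mul_le_mul_of_nonneg_right
        (by simpa using hφ.norm_gradient_sub_le (x + s • h) x) (norm_nonneg h)
    rw [norm_smul, Real.norm_of_nonneg hs.1.le] at hinner
    rw [(hψ s).deriv]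
    linarith
  have h01 : ψ 1 ≤ ψ 0 :=
    hanti (Set.left_mem_Icc.2 zero_le_one) (Set.right_mem_Icc.2 zero_le_one) zero_le_one
  simp only [ψ, one_smul, zero_smul, add_zero] at h01
  linarith

theorem norm_gradient_sq_le (hφ : SmoothWith L φ) (hL : 0 < L) (hb : BddBelow (Set.range φ))
    (x : F) : ‖gradient φ x‖ ^ 2 ≤ 2 * L * (φ x - ⨅ y, φ y) := by
  have hstep := hφ.le_quadratic x (-(1 / L) • gradient φ x)
  have hinf := ciInf_le hb (x + (-(1 / L)) • gradient φ x)
  rw [real_inner_smul_right, real_inner_self_eq_norm_sq, norm_smul, mul_pow, Real.norm_eq_abs,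
    sq_abs] at hstep
  have hgain : 1 / L * ‖gradient φ x‖ ^ 2 - L / 2 * ((-(1 / L)) ^ 2 * ‖gradient φ x‖ ^ 2)
      = ‖gradient φ x‖ ^ 2 / (2 * L) := by
    field_simp
    ring
  rw [mul_comm, ← div_le_iff₀ (by positivity)]
  linarith

theorem inexact_descent (hφ : SmoothWith L φ) (hγ : 0 ≤ γ) (hγL : L * γ ≤ 1 / 2) (x g : F) :
    φ (x - γ • g) + γ / 2 * ‖gradient φ x‖ ^ 2 + γ / 4 * ‖g‖ ^ 2
      ≤ φ x + γ / 2 * ‖g - gradient φ x‖ ^ 2 := by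
  have hquad := hφ.le_quadratic x (-(γ • g))
  rw [← sub_eq_add_neg, inner_neg_right, real_inner_smul_right, norm_neg, norm_smul, mul_pow,
    Real.norm_of_nonneg hγ] at hquad
  have hexpand := norm_sub_sq_real g (gradient φ x)
  rw [real_inner_comm] at hexpand
  have hcurv : L / 2 * (γ ^ 2 * ‖g‖ ^ 2) ≤ γ / 4 * ‖g‖ ^ 2 := by
    have : 0 ≤ γ * ‖g‖ ^ 2 := by positivity
    nlinarith
  rw [hexpand]
  linarith

end SmoothWith

end Smooth

section AvgLoss

variable {n d : ℕ} {f : Fin n → E d → ℝ} {L : ℝ}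

theorem hasGradientAt_avgLoss (hf : ∀ i, Differentiable ℝ (f i)) (x : E d) :
    HasGradientAt (avgLoss f) (mean fun i => gradient (f i) x) x := by
  rw [hasGradientAt_iff_hasFDerivAt, mean, map_smul, map_sum]
  exact (HasFDerivAt.fun_sum fun i _ => (hf i x).hasGradientAt.hasFDerivAt).const_mul _

theorem gradient_avgLoss (hf : ∀ i, Differentiable ℝ (f i)) (x : E d) :
    gradient (avgLoss f) x = mean fun i => gradient (f i) x :=
  (hasGradientAt_avgLoss hf x).gradient

theorem SmoothProblem.smoothWith (hf : SmoothProblem L f) (i : Fin n) : SmoothWith L (f i) :=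
  ⟨hf.differentiable i, hf.smooth i⟩

theorem SmoothProblem.smoothWith_avgLoss (hf : SmoothProblem L f) (hL : 0 ≤ L) :
    SmoothWith L (avgLoss f) where
  differentiable x := (hasGradientAt_avgLoss hf.differentiable x).differentiableAt
  norm_gradient_sub_le x y := by
    rw [gradient_avgLoss hf.differentiable, gradient_avgLoss hf.differentiable, mean, mean,
      ← smul_sub, ← Finset.sum_sub_distrib]
    exact norm_mean_le (by positivity) fun i => hf.smooth i x y

end AvgLoss

/-! ### Gradient descent with double momentum -/

section Tracking

variable {F : Type*} [NormedAddCommGroup F]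

theorem norm_add_three_sq_le (a b c : F) :
    ‖a + b + c‖ ^ 2 ≤ 3 * (‖a‖ ^ 2 + ‖b‖ ^ 2 + ‖c‖ ^ 2) := by
  have hsq : ‖a + b + c‖ ^ 2 ≤ (‖a‖ + ‖b‖ + ‖c‖) ^ 2 := by
    gcongr
    exact norm_add₃_le
  nlinarith [sq_nonneg (‖a‖ - ‖b‖), sq_nonneg (‖a‖ - ‖c‖), sq_nonneg (‖b‖ - ‖c‖)]

theorem norm_sub_add_sub_sq_le (a b c e : F) :
    ‖(a - b) + (c - e)‖ ^ 2 ≤ 4 * (‖a‖ ^ 2 + ‖b‖ ^ 2 + ‖c‖ ^ 2 + ‖e‖ ^ 2) := by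
  have hsq : ‖(a - b) + (c - e)‖ ^ 2 ≤ ((‖a‖ + ‖b‖) + (‖c‖ + ‖e‖)) ^ 2 := by
    gcongr
    exact (norm_add_le _ _).trans (add_le_add (norm_sub_le _ _) (norm_sub_le _ _))
  nlinarith [sq_nonneg (‖a‖ - ‖b‖), sq_nonneg (‖a‖ - ‖c‖), sq_nonneg (‖b‖ - ‖c‖),
    sq_nonneg (‖a‖ - ‖e‖), sq_nonneg (‖b‖ - ‖e‖), sq_nonneg (‖c‖ - ‖e‖)]

variable [NormedSpace ℝ F] {q : ℝ}

theorem norm_one_sub_smul_add_sq_le (hq : 0 < q) (hq1 : q ≤ 1) (y z : F) :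
    ‖(1 - q) • (y + z)‖ ^ 2 ≤ (1 - q) * ‖y‖ ^ 2 + ‖z‖ ^ 2 / q := by
  have hp : 0 ≤ 1 - q := sub_nonneg.2 hq1
  have hYoung : (1 - q) * (‖y‖ + ‖z‖) ^ 2 ≤ ‖y‖ ^ 2 + ‖z‖ ^ 2 / q := by
    have hsq : ‖y‖ ^ 2 + ‖z‖ ^ 2 / q
        = (1 - q) * (‖y‖ + ‖z‖) ^ 2 + ((q * ‖y‖ - (1 - q) * ‖z‖) ^ 2 / q + ‖z‖ ^ 2) := by
      field_simp
      ring
    exact hsq ▸ le_add_of_nonneg_right (by positivity)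
  calc ‖(1 - q) • (y + z)‖ ^ 2 ≤ ((1 - q) * (‖y‖ + ‖z‖)) ^ 2 := by
        rw [norm_smul, Real.norm_of_nonneg hp]
        gcongr
        exact norm_add_le y z
    _ = (1 - q) * ((1 - q) * (‖y‖ + ‖z‖) ^ 2) := by ring
    _ ≤ (1 - q) * (‖y‖ ^ 2 + ‖z‖ ^ 2 / q) := by gcongr
    _ ≤ (1 - q) * ‖y‖ ^ 2 + ‖z‖ ^ 2 / q := by
        rw [mul_add]
        gcongr
        exact mul_le_of_le_one_left (by positivity) (sub_le_self 1 hq.le)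

variable {e z : ℕ → F} {K : ℕ}

theorem sum_norm_sq_add_norm_sq_le_of_contraction (hq : 0 < q) (hq1 : q ≤ 1)
    (h : ∀ t < K, e (t + 1) = (1 - q) • (e t + z t)) :
    q * ∑ t ∈ Finset.range K, ‖e t‖ ^ 2 + ‖e K‖ ^ 2
      ≤ ‖e 0‖ ^ 2 + (∑ t ∈ Finset.range K, ‖z t‖ ^ 2) / q := by
  induction K with
  | zero => simp
  | succ K ih =>
    have hsum := ih fun t ht => h t (ht.trans K.lt_succ_self)
    have hstep := norm_one_sub_smul_add_sq_le hq hq1 (e K) (z K)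
    rw [← h K K.lt_succ_self] at hstep
    rw [Finset.sum_range_succ, Finset.sum_range_succ, add_div]
    linarith

theorem sum_norm_sq_le_of_contraction (hq : 0 < q) (hq1 : q ≤ 1)
    (h : ∀ t < K, e (t + 1) = (1 - q) • (e t + z t)) :
    q * ∑ t ∈ Finset.range (K + 1), ‖e t‖ ^ 2
      ≤ ‖e 0‖ ^ 2 + (∑ t ∈ Finset.range K, ‖z t‖ ^ 2) / q := by
  have hsum := sum_norm_sq_add_norm_sq_le_of_contraction hq hq1 h
  have hlast : q * ‖e K‖ ^ 2 ≤ ‖e K‖ ^ 2 := mul_le_of_le_one_left (sq_nonneg _) hq1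
  rw [Finset.sum_range_succ, mul_add]
  linarith

end Tracking

section Momentum

variable {F : Type*} [NormedAddCommGroup F] [InnerProductSpace ℝ F] [CompleteSpace F]
  {φ : F → ℝ} {L γ β q M : ℝ} {x g v m w : ℕ → F} {K : ℕ}

theorem momentum_bias_succ (hw : ∀ t, w (t + 1) = (1 - β) • w t + β • gradient φ (x (t + 1)))
    (t : ℕ) : w (t + 1) - gradient φ (x (t + 1)) = (1 - β) • ((w t - gradient φ (x t))
      + (gradient φ (x t) - gradient φ (x (t + 1)))) := by
  rw [hw]
  module

namespace SmoothWith

theorem sum_drift_sq_div_le (hφ : SmoothWith L φ) (hβ : 0 < β)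
    (hx : ∀ t, x (t + 1) = x t - γ • g t) (K : ℕ) :
    (∑ t ∈ Finset.range K, ‖gradient φ (x t) - gradient φ (x (t + 1))‖ ^ 2) / β
      ≤ (L * γ) ^ 2 / β * ∑ t ∈ Finset.range K, ‖g t‖ ^ 2 := by
  rw [div_mul_eq_mul_div, Finset.mul_sum]
  gcongr with t
  rw [hx t]
  exact hφ.norm_gradient_sub_step_sq_le γ (x t) (g t)

theorem norm_momentum_bias_sq_le (hφ : SmoothWith L φ) (hβ : 0 < β) (hβ1 : β ≤ 1)
    (hx : ∀ t, x (t + 1) = x t - γ • g t)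
    (hw : ∀ t, w (t + 1) = (1 - β) • w t + β • gradient φ (x (t + 1))) (K : ℕ) :
    ‖w K - gradient φ (x K)‖ ^ 2 ≤ ‖w 0 - gradient φ (x 0)‖ ^ 2
      + (L * γ) ^ 2 / β * ∑ t ∈ Finset.range K, ‖g t‖ ^ 2 := by
  have hsum := sum_norm_sq_add_norm_sq_le_of_contraction (K := K)
    (e := fun t => w t - gradient φ (x t))
    (z := fun t => gradient φ (x t) - gradient φ (x (t + 1))) hβ hβ1
    fun t _ => momentum_bias_succ hw t
  have hnonneg : 0 ≤ β * ∑ t ∈ Finset.range K, ‖w t - gradient φ (x t)‖ ^ 2 := by positivity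
  linarith [hφ.sum_drift_sq_div_le hβ hx K]

theorem sum_norm_momentum_bias_sq_le (hφ : SmoothWith L φ) (hβ : 0 < β) (hβ1 : β ≤ 1)
    (hx : ∀ t, x (t + 1) = x t - γ • g t)
    (hw : ∀ t, w (t + 1) = (1 - β) • w t + β • gradient φ (x (t + 1))) (K : ℕ) :
    β * ∑ t ∈ Finset.range (K + 1), ‖w t - gradient φ (x t)‖ ^ 2 ≤ ‖w 0 - gradient φ (x 0)‖ ^ 2
      + (L * γ) ^ 2 / β * ∑ t ∈ Finset.range K, ‖g t‖ ^ 2 := by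
  have hsum := sum_norm_sq_le_of_contraction (K := K) (e := fun t => w t - gradient φ (x t))
    (z := fun t => gradient φ (x t) - gradient φ (x (t + 1))) hβ hβ1
    fun t _ => momentum_bias_succ hw t
  linarith [hφ.sum_drift_sq_div_le hβ hx K]

theorem sum_descent (hφ : SmoothWith L φ) (hγ : 0 ≤ γ) (hγL : L * γ ≤ 1 / 2)
    (hx : ∀ t, x (t + 1) = x t - γ • g t) (N : ℕ) :
    φ (x N) + γ / 2 * ∑ t ∈ Finset.range N, ‖gradient φ (x t)‖ ^ 2
      + γ / 4 * ∑ t ∈ Finset.range N, ‖g t‖ ^ 2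
      ≤ φ (x 0) + γ / 2 * ∑ t ∈ Finset.range N, ‖g t - gradient φ (x t)‖ ^ 2 := by
  induction N with
  | zero => simp
  | succ N ih =>
    have hstep := hφ.inexact_descent hγ hγL (x N) (g N)
    rw [← hx N] at hstep
    simp only [Finset.sum_range_succ, mul_add]
    linarith

end SmoothWith

/-- Gradient descent on `φ` with step size `γ` along a doubly averaged gradient estimate, up to
time `K`: the momentum `v` consists of the accumulated noise `m` and of an average, with parameter
`β`, of the gradients at the iterates `x`, and the direction `g` is an average of `v`, with
parameter `q`. -/
structure IsDoubleMomentum (φ : F → ℝ) (γ β q : ℝ) (K : ℕ) (x g v m : ℕ → F) : Prop where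
  x_succ : ∀ t, x (t + 1) = x t - γ • g t
  sub_succ : ∀ t,
    v (t + 1) - m (t + 1) = (1 - β) • (v t - m t) + β • gradient φ (x (t + 1))
  g_succ : ∀ t < K, g (t + 1) = g t + q • (v (t + 1) - g t)
  v_zero : v 0 = m 0
  g_zero : g 0 = v 0

namespace IsDoubleMomentum

theorem sum_norm_sub_momentum_sq_le (h : IsDoubleMomentum φ γ β q K x g v m) (hq : 0 < q)
    (hq1 : q ≤ 1) : q ^ 2 * ∑ t ∈ Finset.range (K + 1), ‖g t - v t‖ ^ 2
      ≤ ∑ t ∈ Finset.range K, ‖v t - v (t + 1)‖ ^ 2 := by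
  have htrack := sum_norm_sq_le_of_contraction (K := K) (e := fun t => g t - v t)
    (z := fun t => v t - v (t + 1)) hq hq1 fun t ht => by
      rw [h.g_succ t ht]
      module
  simp only [h.g_zero, sub_self, norm_zero, ne_eq, OfNat.ofNat_ne_zero, not_false_eq_true,
    zero_pow, zero_add] at htrack
  rw [le_div_iff₀ hq] at htrack
  linarith

theorem norm_momentum_sub_succ_sq_le (h : IsDoubleMomentum φ γ β q K x g v m)
    (hφ : SmoothWith L φ) (hβ : 0 ≤ β) (hβ1 : β ≤ 1) {t : ℕ} (hm : ‖m t‖ ^ 2 ≤ M)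
    (hm' : ‖m (t + 1)‖ ^ 2 ≤ M) : ‖v t - v (t + 1)‖ ^ 2
      ≤ 8 * M + 4 * (L * γ) ^ 2 * ‖g t‖ ^ 2 + 4 * ‖v t - m t - gradient φ (x t)‖ ^ 2 := by
  have hβ2 : β ^ 2 ≤ 1 := pow_le_one₀ hβ hβ1
  have hsplit : v t - v (t + 1) = (m t - m (t + 1))
      + (β • (gradient φ (x t) - gradient φ (x (t + 1)))
        - (-β) • (v t - m t - gradient φ (x t))) := by
    rw [← sub_add_cancel (v (t + 1)) (m (t + 1)), h.sub_succ t]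
    module
  have hdrift : β ^ 2 * ‖gradient φ (x t) - gradient φ (x (t + 1))‖ ^ 2
      ≤ (L * γ) ^ 2 * ‖g t‖ ^ 2 := by
    rw [h.x_succ t]
    exact (mul_le_of_le_one_left (sq_nonneg _) hβ2).trans
      (hφ.norm_gradient_sub_step_sq_le γ (x t) (g t))
  have hbias : β ^ 2 * ‖v t - m t - gradient φ (x t)‖ ^ 2
      ≤ ‖v t - m t - gradient φ (x t)‖ ^ 2 := mul_le_of_le_one_left (sq_nonneg _) hβ2
  have hfour := norm_sub_add_sub_sq_le (m t) (m (t + 1))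
    (β • (gradient φ (x t) - gradient φ (x (t + 1)))) ((-β) • (v t - m t - gradient φ (x t)))
  rw [← hsplit, norm_smul, norm_smul, norm_neg, Real.norm_of_nonneg hβ, mul_pow, mul_pow] at hfour
  linarith

theorem sum_norm_momentum_sub_succ_sq_le (h : IsDoubleMomentum φ γ β q K x g v m)
    (hφ : SmoothWith L φ) (hβ : 0 ≤ β) (hβ1 : β ≤ 1) (hM : ∀ t ≤ K, ‖m t‖ ^ 2 ≤ M) :
    ∑ t ∈ Finset.range K, ‖v t - v (t + 1)‖ ^ 2 ≤ 8 * ((K + 1) * M)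
      + 4 * (L * γ) ^ 2 * ∑ t ∈ Finset.range (K + 1), ‖g t‖ ^ 2
      + 4 * ∑ t ∈ Finset.range (K + 1), ‖v t - m t - gradient φ (x t)‖ ^ 2 := by
  have hM0 : 0 ≤ M := (sq_nonneg _).trans (hM 0 K.zero_le)
  calc ∑ t ∈ Finset.range K, ‖v t - v (t + 1)‖ ^ 2
      ≤ ∑ t ∈ Finset.range K, (8 * M + 4 * (L * γ) ^ 2 * ‖g t‖ ^ 2
          + 4 * ‖v t - m t - gradient φ (x t)‖ ^ 2) :=
        Finset.sum_le_sum fun t ht => by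
          have htK := Finset.mem_range.1 ht
          exact h.norm_momentum_sub_succ_sq_le hφ hβ hβ1 (hM t htK.le) (hM (t + 1) htK)
    _ ≤ ∑ t ∈ Finset.range (K + 1), (8 * M + 4 * (L * γ) ^ 2 * ‖g t‖ ^ 2
          + 4 * ‖v t - m t - gradient φ (x t)‖ ^ 2) := by
        rw [Finset.sum_range_succ]
        exact le_add_of_nonneg_right (by positivity)
    _ = _ := by
        simp only [Finset.sum_add_distrib, ← Finset.mul_sum, Finset.sum_const, Finset.card_range,
          nsmul_eq_mul]
        push_cast
        ring

theorem sum_norm_sub_gradient_sq_le (h : IsDoubleMomentum φ γ β q K x g v m)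
    (hφ : SmoothWith L φ) (hβ : 0 ≤ β) (hβ1 : β ≤ 1) (hq : 0 < q) (hq1 : q ≤ 1)
    (hM : ∀ t ≤ K, ‖m t‖ ^ 2 ≤ M) :
    q ^ 2 * ∑ t ∈ Finset.range (K + 1), ‖g t - gradient φ (x t)‖ ^ 2 ≤ 27 * ((K + 1) * M)
      + 12 * (L * γ) ^ 2 * ∑ t ∈ Finset.range (K + 1), ‖g t‖ ^ 2
      + 15 * ∑ t ∈ Finset.range (K + 1), ‖v t - m t - gradient φ (x t)‖ ^ 2 := by
  set U := ∑ t ∈ Finset.range (K + 1), ‖v t - m t - gradient φ (x t)‖ ^ 2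
  have hM0 : 0 ≤ M := (sq_nonneg _).trans (hM 0 K.zero_le)
  have hsplit : ∑ t ∈ Finset.range (K + 1), ‖g t - gradient φ (x t)‖ ^ 2
      ≤ 3 * (∑ t ∈ Finset.range (K + 1), ‖g t - v t‖ ^ 2 + U + (K + 1) * M) := by
    calc ∑ t ∈ Finset.range (K + 1), ‖g t - gradient φ (x t)‖ ^ 2
        ≤ ∑ t ∈ Finset.range (K + 1),
            3 * (‖g t - v t‖ ^ 2 + ‖v t - m t - gradient φ (x t)‖ ^ 2 + M) :=
          Finset.sum_le_sum fun t ht => by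
            have hthree := norm_add_three_sq_le (g t - v t) (v t - m t - gradient φ (x t)) (m t)
            rw [show (g t - v t) + (v t - m t - gradient φ (x t)) + m t
              = g t - gradient φ (x t) by abel] at hthree
            linarith [hM t (Finset.mem_range_succ_iff.1 ht)]
      _ = _ := by
          rw [← Finset.mul_sum, Finset.sum_add_distrib, Finset.sum_add_distrib, Finset.sum_const,
            Finset.card_range, nsmul_eq_mul]
          push_cast
          rfl
  have hq2 : q ^ 2 * (U + (K + 1) * M) ≤ U + (K + 1) * M :=
    mul_le_of_le_one_left (by positivity) (pow_le_one₀ hq.le hq1)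
  have hscaled := mul_le_mul_of_nonneg_left hsplit (sq_nonneg q)
  linarith [h.sum_norm_sub_momentum_sq_le hq hq1,
    h.sum_norm_momentum_sub_succ_sq_le hφ hβ hβ1 hM]

theorem sum_norm_bias_sq_le (h : IsDoubleMomentum φ γ β q K x g v m) (hφ : SmoothWith L φ)
    (hL : 0 < L) (hb : BddBelow (Set.range φ)) (hβ : 0 < β) (hβ1 : β ≤ 1) :
    β * ∑ t ∈ Finset.range (K + 1), ‖v t - m t - gradient φ (x t)‖ ^ 2
      ≤ 2 * L * (φ (x 0) - ⨅ y, φ y)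
        + (L * γ) ^ 2 / β * ∑ t ∈ Finset.range (K + 1), ‖g t‖ ^ 2 := by
  have hinit : ‖v 0 - m 0 - gradient φ (x 0)‖ ^ 2 ≤ 2 * L * (φ (x 0) - ⨅ y, φ y) := by
    rw [h.v_zero, sub_self, zero_sub, norm_neg]
    exact hφ.norm_gradient_sq_le hL hb (x 0)
  have hS : (L * γ) ^ 2 / β * ∑ t ∈ Finset.range K, ‖g t‖ ^ 2
      ≤ (L * γ) ^ 2 / β * ∑ t ∈ Finset.range (K + 1), ‖g t‖ ^ 2 := by
    gcongr
    exact K.le_succ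
  linarith [hφ.sum_norm_momentum_bias_sq_le (w := fun t => v t - m t) hβ hβ1 h.x_succ h.sub_succ K]

theorem step_mul_sum_norm_sub_gradient_sq_le (h : IsDoubleMomentum φ γ β q K x g v m)
    (hφ : SmoothWith L φ) (hb : BddBelow (Set.range φ)) (hL : 0 < L) (hβ : 0 < β) (hβ1 : β ≤ 1)
    (hq : 0 < q) (hq1 : q ≤ 1) (hγ : 0 ≤ γ) (hγL : 108 * (L * γ) ≤ q ^ 2 * β)
    (hM : ∀ t ≤ K, ‖m t‖ ^ 2 ≤ M) :
    γ / 2 * ∑ t ∈ Finset.range (K + 1), ‖g t - gradient φ (x t)‖ ^ 2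
      ≤ β * (K + 1) * M / (8 * L) + γ / 8 * ∑ t ∈ Finset.range (K + 1), ‖g t‖ ^ 2
        + 1 / 4 * (φ (x 0) - ⨅ y, φ y) := by
  set S := ∑ t ∈ Finset.range (K + 1), ‖g t‖ ^ 2
  set R := ∑ t ∈ Finset.range (K + 1), ‖g t - gradient φ (x t)‖ ^ 2
  have : 0 ≤ S := Finset.sum_nonneg fun _ _ => sq_nonneg _
  have : 0 ≤ R := Finset.sum_nonneg fun _ _ => sq_nonneg _
  have hgap : 0 ≤ φ (x 0) - ⨅ y, φ y := sub_nonneg.2 (ciInf_le hb _)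
  have hLγβ : L * γ ≤ β := by nlinarith [pow_le_one₀ hq.le hq1 (n := 2)]
  have herr := mul_le_mul_of_nonneg_left
    (h.sum_norm_sub_gradient_sq_le hφ hβ.le hβ1 hq hq1 hM) hβ.le
  have hbias := h.sum_norm_bias_sq_le hφ hL hb hβ hβ1
  have hdrift : (L * γ) ^ 2 / β * S ≤ L * γ * S := by
    gcongr
    rw [div_le_iff₀ hβ, sq]
    gcongr
  have hdrift' : β * ((L * γ) ^ 2 * S) ≤ L * γ * S := by
    calc β * ((L * γ) ^ 2 * S) = β * (L * γ) * (L * γ * S) := by ring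
      _ ≤ L * γ * S := mul_le_of_le_one_left (by positivity)
          (mul_le_one₀ hβ1 (by positivity) (hLγβ.trans hβ1))
  have hscale : 108 * (L * γ) * R ≤ q ^ 2 * β * R := by gcongr
  rw [← sub_nonneg]
  have hexpand : β * (K + 1) * M / (8 * L) + γ / 8 * S + 1 / 4 * (φ (x 0) - ⨅ y, φ y) - γ / 2 * R
      = (27 * (β * ((K + 1) * M)) + 27 * (L * γ * S) + 54 * L * (φ (x 0) - ⨅ y, φ y)
        - 108 * (L * γ) * R) / (216 * L) := by
    field_simp
    ring
  rw [hexpand]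
  have : 0 ≤ L * (φ (x 0) - ⨅ y, φ y) := by positivity
  exact div_nonneg (by linarith) (by positivity)

theorem energy_le (h : IsDoubleMomentum φ γ β q K x g v m)
    (hφ : SmoothWith L φ) (hb : BddBelow (Set.range φ)) (hL : 0 < L) (hβ : 0 < β) (hβ1 : β ≤ 1)
    (hq : 0 < q) (hq1 : q ≤ 1) (hγ : 0 ≤ γ) (hγL : 108 * (L * γ) ≤ q ^ 2 * β)
    (hM : ∀ t ≤ K, ‖m t‖ ^ 2 ≤ M) :
    γ / 2 * ∑ t ∈ Finset.range (K + 1), ‖gradient φ (x t)‖ ^ 2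
      + γ / 8 * ∑ t ∈ Finset.range (K + 1), ‖g t‖ ^ 2
      ≤ 5 / 4 * (φ (x 0) - ⨅ y, φ y) + β * (K + 1) * M / (8 * L) := by
  have hγL' : L * γ ≤ 1 / 2 := by nlinarith [pow_le_one₀ hq.le hq1 (n := 2)]
  have hdescent := hφ.sum_descent hγ hγL' h.x_succ (K + 1)
  have hinf := ciInf_le hb (x (K + 1))
  linarith [h.step_mul_sum_norm_sub_gradient_sq_le hφ hb hL hβ hβ1 hq hq1 hγ hγL hM]

end IsDoubleMomentum

end Momentum

/-! ### Runs without clipping -/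

section Run

variable {n d : ℕ}

theorem clip_of_norm_le {τ : ℝ} {y : E d} (h : ‖y‖ ≤ τ) : clip τ y = y := if_neg h.not_gt

/-- The error of the stochastic gradient that worker `i` evaluates at `xᵗ`, along the run with
samples `s`. Iteration `t - 1 → t` consumes `noise … t`; the value at `t = 0` is never used. -/
noncomputable def noise {Ξ : Type*} (f : Fin n → E d → ℝ) (γ β β' τ : ℝ)
    (G : Fin n → E d → Ξ → E d) (x0 : E d) (s : ℕ → Fin n → Ξ) (t : ℕ) (i : Fin n) : E d :=
  G i (run γ β β' τ G x0 s t).x (s t i) - gradient (f i) (run γ β β' τ G x0 s t).x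

/-- The sequence of states `R` is a run of Clip21-SGD2M from `x0` whose stochastic gradients are
the true gradients plus the errors `ε`. This forgets the oracle, so that the convergence argument
is deterministic; `g` is given as the mean of the local estimates instead of by its recursion. -/
structure IsNoisyRun (f : Fin n → E d → ℝ) (γ β q τ : ℝ) (x0 : E d) (ε : ℕ → Fin n → E d)
    (R : ℕ → State n d) : Prop where
  x_zero : (R 0).x = x0
  v_zero : ∀ i, (R 0).v i = 0
  gl_zero : ∀ i, (R 0).gl i = 0
  g_eq : ∀ t, (R t).g = mean (R t).gl
  x_succ : ∀ t, (R (t + 1)).x = (R t).x - γ • (R t).g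
  v_succ : ∀ t i,
    (R (t + 1)).v i = (1 - β) • (R t).v i + β • (ε (t + 1) i + gradient (f i) (R (t + 1)).x)
  gl_succ : ∀ t i, (R (t + 1)).gl i = (R t).gl i + q • clip τ ((R (t + 1)).v i - (R t).gl i)

theorem run_g_eq_mean {Ξ : Type*} (γ β q τ : ℝ) (G : Fin n → E d → Ξ → E d) (x0 : E d)
    (s : ℕ → Fin n → Ξ) (t : ℕ) :
    (run γ β q τ G x0 s t).g = mean (run γ β q τ G x0 s t).gl := by
  induction t with
  | zero => simp [run, mean]
  | succ t ih =>
    simp only [run, step, mean, ih, Finset.sum_add_distrib, ← Finset.smul_sum, smul_add, smul_smul]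
    congr 2
    ring

theorem isNoisyRun_run {Ξ : Type*} (f : Fin n → E d → ℝ) (γ β q τ : ℝ)
    (G : Fin n → E d → Ξ → E d) (x0 : E d) (s : ℕ → Fin n → Ξ) :
    IsNoisyRun f γ β q τ x0 (noise f γ β q τ G x0 s) (run γ β q τ G x0 s) where
  x_zero := rfl
  v_zero _ := rfl
  gl_zero _ := rfl
  g_eq := run_g_eq_mean γ β q τ G x0 s
  x_succ _ := rfl
  v_succ t i := by
    rw [noise, sub_add_cancel]
    rfl
  gl_succ _ _ := rfl

/-- In the first `K` iterations of `R` no worker clips. -/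
def NoClip (R : ℕ → State n d) (τ : ℝ) (K : ℕ) : Prop :=
  ∀ t < K, ∀ i, ‖(R (t + 1)).v i - (R t).gl i‖ ≤ τ

/-- Bounds on the errors `ε` and on their moving averages with parameter `β`, per worker and for
the mean over the workers, up to time `T`. A larger `ι` makes them hold with larger probability. -/
structure NoiseBounds (ε : ℕ → Fin n → E d) (β σ ι : ℝ) (T : ℕ) : Prop where
  sample : ∀ t < T, ∀ i, ‖ε (t + 1) i‖ ^ 2 ≤ 16 * σ ^ 2 * ι
  local_avg : ∀ t < T, ∀ i, ‖movingAvg β (fun r => ε r i) t‖ ^ 2 ≤ 16 * β * σ ^ 2 * ι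
  avg : ∀ t < T, ‖movingAvg β (fun r => mean (ε r)) t‖ ^ 2 ≤ 16 * β * (σ ^ 2 / n) * ι

/-- The conditions on the step size `γ` and the momentum parameter `β` under which the convergence
argument works. The last one says that the momenta move too slowly to trigger clipping. -/
structure IsTuned (n T : ℕ) (L Δ B τ σ q ι γ β : ℝ) : Prop where
  step_pos : 0 < γ
  momentum_pos : 0 < β
  momentum_le_one : β ≤ 1
  step_le : 108 * (L * γ) ≤ q ^ 2 * β
  noise_le : β ^ 2 * T * σ ^ 2 ≤ n * (L * Δ)
  drift_le : 8 * β * ι * (σ + B + √(L * Δ)) ≤ q * τ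

variable {f : Fin n → E d → ℝ} {L Δ B γ β q τ σ ι ρ : ℝ} {x0 : E d} {ε : ℕ → Fin n → E d}
  {R : ℕ → State n d} {T K : ℕ}

namespace NoiseBounds

theorem sixteen_mul_sq_mul_le (hι : 1 ≤ ι) : 16 * σ ^ 2 * ι ≤ (4 * σ * ι) ^ 2 := by
  calc 16 * σ ^ 2 * ι ≤ 16 * σ ^ 2 * ι ^ 2 := by
        gcongr
        exact le_self_pow₀ hι two_ne_zero
    _ = (4 * σ * ι) ^ 2 := by ring

theorem norm_sample_le (hN : NoiseBounds ε β σ ι T) (hσ : 0 ≤ σ) (hι : 1 ≤ ι) (hK : K < T)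
    (i : Fin n) : ‖ε (K + 1) i‖ ≤ 4 * σ * ι :=
  le_of_sq_le_sq ((hN.sample K hK i).trans (sixteen_mul_sq_mul_le hι)) (by positivity)

theorem norm_movingAvg_le (hN : NoiseBounds ε β σ ι T) (hσ : 0 ≤ σ) (hι : 1 ≤ ι) (hβ1 : β ≤ 1)
    (hK : K < T) (i : Fin n) : ‖movingAvg β (fun r => ε r i) K‖ ≤ 4 * σ * ι := by
  have hβ : 16 * β * σ ^ 2 * ι ≤ 16 * σ ^ 2 * ι := by
    gcongr
    linarith
  exact le_of_sq_le_sq ((hN.local_avg K hK i).trans (hβ.trans (sixteen_mul_sq_mul_le hι)))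
    (by positivity)

end NoiseBounds

namespace IsTuned

theorem noise_energy_le (hP : IsTuned n T L Δ B τ σ q ι γ β) (hn : 1 ≤ n) (hL : 0 < L)
    (hι : 0 ≤ ι) (hK : K < T) :
    β * (K + 1) * (16 * β * (σ ^ 2 / n) * ι) / (8 * L) ≤ 2 * ι * Δ := by
  have : (0 : ℝ) < n := by exact_mod_cast hn
  have hKT : (K : ℝ) + 1 ≤ T := by exact_mod_cast hK
  have hβ := hP.momentum_pos
  rw [div_le_iff₀ (by positivity)]
  calc β * (K + 1) * (16 * β * (σ ^ 2 / n) * ι) ≤ β * T * (16 * β * (σ ^ 2 / n) * ι) := by gcongr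
    _ = 16 * ι * (β ^ 2 * T * σ ^ 2) / n := by ring
    _ ≤ 16 * ι * (n * (L * Δ)) / n := by
        gcongr 16 * ι * ?_ / n
        exact hP.noise_le
    _ = 2 * ι * Δ * (8 * L) := by
        field_simp
        ring

theorem drift_energy_le (hP : IsTuned n T L Δ B τ σ q ι γ β) (hL : 0 < L) (hΔ : 0 ≤ Δ)
    (hq : 0 ≤ q) (hq1 : q ≤ 1) (hι : 1 ≤ ι) {S : ℝ} (hS : γ / 8 * S ≤ 4 * ι * Δ) :
    (L * γ) ^ 2 / β * S ≤ (ι * √(L * Δ)) ^ 2 := by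
  have hβ := hP.momentum_pos
  have hγ := hP.step_pos
  have hratio : L * γ / β ≤ 1 / 32 := by
    rw [div_le_iff₀ hβ]
    have hq2 : q ^ 2 * β ≤ β := mul_le_of_le_one_left hβ.le (pow_le_one₀ hq hq1)
    linarith [hP.step_le]
  calc (L * γ) ^ 2 / β * S = L * γ / β * (8 * L) * (γ / 8 * S) := by ring
    _ ≤ L * γ / β * (8 * L) * (4 * ι * Δ) := by gcongr
    _ ≤ 1 / 32 * (8 * L) * (4 * ι * Δ) := by gcongr
    _ = ι * (L * Δ) := by ring
    _ ≤ ι ^ 2 * (L * Δ) := by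
        gcongr
        exact le_self_pow₀ hι two_ne_zero
    _ = (ι * √(L * Δ)) ^ 2 := by rw [mul_pow, Real.sq_sqrt (by positivity)]

end IsTuned

theorem sub_movingAvg_succ {F : Type*} [AddCommGroup F] [Module ℝ F] {b : ℝ} {v y : ℕ → F} {a : F}
    {t : ℕ} (h : v (t + 1) = (1 - b) • v t + b • (y (t + 1) + a)) :
    v (t + 1) - movingAvg b y (t + 1) = (1 - b) • (v t - movingAvg b y t) + b • a := by
  rw [h, movingAvg]
  module

namespace IsNoisyRun

theorem isDoubleMomentum (h : IsNoisyRun f γ β q τ x0 ε R) (hf : ∀ i, Differentiable ℝ (f i))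
    (hclip : NoClip R τ K) :
    IsDoubleMomentum (avgLoss f) γ β q K (fun t => (R t).x) (fun t => (R t).g)
      (fun t => mean (R t).v) (movingAvg β fun t => mean (ε t)) where
  x_succ := h.x_succ
  sub_succ t := by
    refine sub_movingAvg_succ (v := fun t => mean (R t).v) ?_
    simp only [gradient_avgLoss hf, mean, h.v_succ, Finset.sum_add_distrib, ← Finset.smul_sum]
    module
  g_succ t ht := by
    simp only [h.g_eq, mean, h.gl_succ, clip_of_norm_le (hclip t ht _), Finset.sum_add_distrib,
      Finset.sum_sub_distrib, ← Finset.smul_sum]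
    module
  v_zero := by simp [mean, h.v_zero, movingAvg]
  g_zero := by simp [h.g_eq, mean, h.v_zero, h.gl_zero]

theorem energy_le_of_noClip (h : IsNoisyRun f γ β q τ x0 ε R)
    (hP : IsTuned n T L Δ B τ σ q ι γ β) (hN : NoiseBounds ε β σ ι T) (hn : 1 ≤ n)
    (hf : SmoothProblem L f) (hL : 0 < L) (hΔ : avgLoss f x0 - (⨅ x, avgLoss f x) ≤ Δ)
    (hq : 0 < q) (hq1 : q ≤ 1) (hι : 1 ≤ ι) (hK : K < T) (hclip : NoClip R τ K) :
    γ / 2 * ∑ t ∈ Finset.range (K + 1), ‖gradient (avgLoss f) (R t).x‖ ^ 2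
      + γ / 8 * ∑ t ∈ Finset.range (K + 1), ‖(R t).g‖ ^ 2 ≤ 4 * ι * Δ := by
  have henergy := (h.isDoubleMomentum hf.differentiable hclip).energy_le
    (hf.smoothWith_avgLoss hL.le) hf.bddBelow hL hP.momentum_pos hP.momentum_le_one hq hq1
    hP.step_pos.le hP.step_le fun t ht => hN.avg t (ht.trans_lt hK)
  have hgap : 0 ≤ avgLoss f x0 - ⨅ x, avgLoss f x := sub_nonneg.2 (ciInf_le hf.bddBelow x0)
  have hιΔ : Δ ≤ ι * Δ := le_mul_of_one_le_left (hgap.trans hΔ) hι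
  rw [h.x_zero] at henergy
  linarith [hP.noise_energy_le hn hL (zero_le_one.trans hι) hK]

theorem norm_gl_sub_v_le_of_noClip (h : IsNoisyRun f γ β q τ x0 ε R) (hq1 : q ≤ 1) (hτ : 0 ≤ τ)
    (hclip : NoClip R τ K) (i : Fin n) : ‖(R K).gl i - (R K).v i‖ ≤ (1 - q) * τ := by
  have hp : 0 ≤ 1 - q := sub_nonneg.2 hq1
  cases K with
  | zero => simpa [h.gl_zero, h.v_zero] using mul_nonneg hp hτ
  | succ K =>
    have hK := hclip K K.lt_succ_self i
    calc ‖(R (K + 1)).gl i - (R (K + 1)).v i‖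
        = ‖(1 - q) • ((R K).gl i - (R (K + 1)).v i)‖ := by
          rw [h.gl_succ, clip_of_norm_le hK]
          congr 1
          module
      _ ≤ (1 - q) * τ := by
          rw [norm_smul, Real.norm_of_nonneg hp, norm_sub_rev]
          gcongr

theorem norm_bias_le (h : IsNoisyRun f γ β q τ x0 ε R) (hf : SmoothProblem L f) (hβ : 0 < β)
    (hβ1 : β ≤ 1) (hB : ∀ i, ‖gradient (f i) x0‖ ≤ B) (hρ : 0 ≤ ρ)
    (hS : (L * γ) ^ 2 / β * ∑ t ∈ Finset.range (K + 1), ‖(R t).g‖ ^ 2 ≤ ρ ^ 2) (i : Fin n) :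
    ‖(R K).v i - movingAvg β (fun r => ε r i) K - gradient (f i) (R K).x‖ ≤ B + ρ := by
  have hbias := (hf.smoothWith i).norm_momentum_bias_sq_le (x := fun t => (R t).x)
    (g := fun t => (R t).g) (w := fun t => (R t).v i - movingAvg β (fun r => ε r i) t) hβ hβ1
    h.x_succ (fun t => sub_movingAvg_succ (v := fun t => (R t).v i) (y := fun r => ε r i)
      (h.v_succ t i)) K
  have hinit : ‖(R 0).v i - movingAvg β (fun r => ε r i) 0 - gradient (f i) (R 0).x‖ ≤ B := by
    simpa [h.v_zero, h.x_zero, movingAvg] using hB i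
  have hB0 : 0 ≤ B := (norm_nonneg _).trans (hB i)
  have hmono : (L * γ) ^ 2 / β * ∑ t ∈ Finset.range K, ‖(R t).g‖ ^ 2
      ≤ (L * γ) ^ 2 / β * ∑ t ∈ Finset.range (K + 1), ‖(R t).g‖ ^ 2 := by
    gcongr
    exact K.le_succ
  refine le_of_sq_le_sq ?_ (by positivity)
  linarith [pow_le_pow_left₀ (norm_nonneg _) hinit 2, mul_nonneg hB0 hρ, add_sq B ρ]

theorem norm_gradient_succ_sub_le (h : IsNoisyRun f γ β q τ x0 ε R) (hf : SmoothProblem L f)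
    (hβ : 0 < β) (hβ1 : β ≤ 1) (hρ : 0 ≤ ρ)
    (hS : (L * γ) ^ 2 / β * ∑ t ∈ Finset.range (K + 1), ‖(R t).g‖ ^ 2 ≤ ρ ^ 2) (i : Fin n) :
    ‖gradient (f i) (R (K + 1)).x - gradient (f i) (R K).x‖ ≤ ρ := by
  refine le_of_sq_le_sq ?_ hρ
  calc ‖gradient (f i) (R (K + 1)).x - gradient (f i) (R K).x‖ ^ 2
      ≤ (L * γ) ^ 2 * ‖(R K).g‖ ^ 2 := by
        rw [norm_sub_rev, h.x_succ]
        exact (hf.smoothWith i).norm_gradient_sub_step_sq_le γ (R K).x (R K).g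
    _ ≤ (L * γ) ^ 2 / β * ∑ t ∈ Finset.range (K + 1), ‖(R t).g‖ ^ 2 := by
        gcongr
        · exact le_div_self (sq_nonneg _) hβ hβ1
        · exact Finset.single_le_sum (f := fun t => ‖(R t).g‖ ^ 2) (fun _ _ => sq_nonneg _)
            (Finset.self_mem_range_succ K)
    _ ≤ ρ ^ 2 := hS

theorem norm_v_succ_sub_v_le (h : IsNoisyRun f γ β q τ x0 ε R)
    (hP : IsTuned n T L Δ B τ σ q ι γ β) (hN : NoiseBounds ε β σ ι T) (hf : SmoothProblem L f)
    (hB : ∀ i, ‖gradient (f i) x0‖ ≤ B) (hσ : 0 ≤ σ) (hι : 1 ≤ ι) (hK : K < T)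
    (hS : (L * γ) ^ 2 / β * ∑ t ∈ Finset.range (K + 1), ‖(R t).g‖ ^ 2 ≤ (ι * √(L * Δ)) ^ 2)
    (i : Fin n) : ‖(R (K + 1)).v i - (R K).v i‖ ≤ q * τ := by
  have hβ := hP.momentum_pos
  have hB0 : 0 ≤ B := (norm_nonneg _).trans (hB i)
  have hρ : 0 ≤ ι * √(L * Δ) := by positivity
  have hsplit : (R (K + 1)).v i - (R K).v i
      = β • ((ε (K + 1) i - movingAvg β (fun r => ε r i) K)
        + ((gradient (f i) (R (K + 1)).x - gradient (f i) (R K).x)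
          - ((R K).v i - movingAvg β (fun r => ε r i) K - gradient (f i) (R K).x))) := by
    rw [h.v_succ]
    module
  calc ‖(R (K + 1)).v i - (R K).v i‖
      ≤ β * ((4 * σ * ι + 4 * σ * ι) + (ι * √(L * Δ) + (B + ι * √(L * Δ)))) := by
        rw [hsplit, norm_smul, Real.norm_of_nonneg hβ.le]
        gcongr
        exact norm_add_le_of_le
          (norm_sub_le_of_le (hN.norm_sample_le hσ hι hK i)
            (hN.norm_movingAvg_le hσ hι hP.momentum_le_one hK i))
          (norm_sub_le_of_le (h.norm_gradient_succ_sub_le hf hβ hP.momentum_le_one hρ hS i)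
            (h.norm_bias_le hf hβ hP.momentum_le_one hB hρ hS i))
    _ ≤ β * (8 * ι * (σ + B + √(L * Δ))) := by
        gcongr
        linarith [le_mul_of_one_le_left hB0 hι]
    _ = 8 * β * ι * (σ + B + √(L * Δ)) := by ring
    _ ≤ q * τ := hP.drift_le

theorem noClip (h : IsNoisyRun f γ β q τ x0 ε R) (hP : IsTuned n T L Δ B τ σ q ι γ β)
    (hN : NoiseBounds ε β σ ι T) (hn : 1 ≤ n) (hf : SmoothProblem L f) (hL : 0 < L)
    (hΔ : avgLoss f x0 - (⨅ x, avgLoss f x) ≤ Δ) (hB : ∀ i, ‖gradient (f i) x0‖ ≤ B)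
    (hσ : 0 ≤ σ) (hq : 0 < q) (hq1 : q ≤ 1) (hι : 1 ≤ ι) (hτ : 0 ≤ τ) (hK : K ≤ T) :
    NoClip R τ K := by
  induction K with
  | zero => exact fun _ ht => absurd ht (Nat.not_lt_zero _)
  | succ K ih =>
    have hclip := ih (Nat.le_of_succ_le hK)
    have hΔ0 : 0 ≤ Δ := (sub_nonneg.2 (ciInf_le hf.bddBelow x0)).trans hΔ
    have hγ := hP.step_pos
    have hS : γ / 8 * ∑ t ∈ Finset.range (K + 1), ‖(R t).g‖ ^ 2 ≤ 4 * ι * Δ :=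
      le_of_add_le_of_nonneg_right
        (h.energy_le_of_noClip hP hN hn hf hL hΔ hq hq1 hι hK hclip) (by positivity)
    intro t ht i
    rcases Nat.lt_succ_iff_lt_or_eq.1 ht with ht | rfl
    · exact hclip t ht i
    · calc ‖(R (t + 1)).v i - (R t).gl i‖
          = ‖((R (t + 1)).v i - (R t).v i) - ((R t).gl i - (R t).v i)‖ := by
            rw [sub_sub_sub_cancel_right]
        _ ≤ q * τ + (1 - q) * τ := norm_sub_le_of_le
            (h.norm_v_succ_sub_v_le hP hN hf hB hσ hι hK
              (hP.drift_energy_le hL hΔ0 hq.le hq1 hι hS) i)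
            (h.norm_gl_sub_v_le_of_noClip hq1 hτ hclip i)
        _ = τ := by ring

theorem sum_norm_gradient_sq_le (h : IsNoisyRun f γ β q τ x0 ε R)
    (hP : IsTuned n T L Δ B τ σ q ι γ β) (hN : NoiseBounds ε β σ ι T) (hn : 1 ≤ n) (hT : 1 ≤ T)
    (hf : SmoothProblem L f) (hL : 0 < L) (hΔ : avgLoss f x0 - (⨅ x, avgLoss f x) ≤ Δ)
    (hB : ∀ i, ‖gradient (f i) x0‖ ≤ B) (hσ : 0 ≤ σ) (hq : 0 < q) (hq1 : q ≤ 1) (hι : 1 ≤ ι)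
    (hτ : 0 ≤ τ) :
    γ / 2 * ∑ t ∈ Finset.range T, ‖gradient (avgLoss f) (R t).x‖ ^ 2 ≤ 4 * ι * Δ := by
  obtain ⟨K, rfl⟩ : ∃ K, T = K + 1 := Nat.exists_eq_add_of_le' hT
  have hγ := hP.step_pos
  exact le_of_add_le_of_nonneg_left (h.energy_le_of_noClip hP hN hn hf hL hΔ hq hq1 hι
    K.lt_succ_self (h.noClip hP hN hn hf hL hΔ hB hσ hq hq1 hι hτ K.le_succ)) (by positivity)

end IsNoisyRun

end Run

/-! ### Concentration of the noise -/

section Measurability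

variable {n d : ℕ} {Ξ Ω : Type*} [MeasurableSpace Ξ]

instance : MeasurableSpace (State n d) :=
  MeasurableSpace.comap (fun S => (S.x, S.g, S.v, S.gl)) inferInstance

theorem measurable_state_iff [MeasurableSpace Ω] {S : Ω → State n d} :
    Measurable S ↔ Measurable fun ω => ((S ω).x, (S ω).g, (S ω).v, (S ω).gl) :=
  measurable_comap_iff

@[fun_prop]
theorem State.measurable_x : Measurable (State.x : State n d → E d) :=
  (measurable_state_iff.1 measurable_id).fst

@[fun_prop]
theorem State.measurable_g : Measurable (State.g : State n d → E d) :=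
  (measurable_state_iff.1 measurable_id).snd.fst

@[fun_prop]
theorem State.measurable_v : Measurable (State.v : State n d → Fin n → E d) :=
  (measurable_state_iff.1 measurable_id).snd.snd.fst

@[fun_prop]
theorem State.measurable_gl : Measurable (State.gl : State n d → Fin n → E d) :=
  (measurable_state_iff.1 measurable_id).snd.snd.snd

@[fun_prop]
theorem measurable_clip (τ : ℝ) : Measurable (clip (d := d) τ) :=
  Measurable.ite (measurableSet_lt measurable_const measurable_norm) (by fun_prop) measurable_id

variable {γ β β' τ : ℝ} {G : Fin n → E d → Ξ → E d} {x0 : E d}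

theorem measurable_step (hG : ∀ i, Measurable fun p : E d × Ξ => G i p.1 p.2) :
    Measurable fun p : State n d × (Fin n → Ξ) => step γ β β' τ G p.2 p.1 := by
  have hx : Measurable fun p : State n d × (Fin n → Ξ) => p.1.x - γ • p.1.g := by fun_prop
  have hv : ∀ i, Measurable fun p : State n d × (Fin n → Ξ) =>
      (1 - β) • p.1.v i + β • G i (p.1.x - γ • p.1.g) (p.2 i) := by fun_prop
  have : ∀ i, Measurable fun p : State n d × (Fin n → Ξ) =>
      clip τ ((1 - β) • p.1.v i + β • G i (p.1.x - γ • p.1.g) (p.2 i) - p.1.gl i) := by fun_prop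
  have hg : Measurable fun p : State n d × (Fin n → Ξ) => p.1.g + (β' / (n : ℝ)) •
      ∑ i, clip τ ((1 - β) • p.1.v i + β • G i (p.1.x - γ • p.1.g) (p.2 i) - p.1.gl i) := by
    fun_prop
  have hgl : ∀ i, Measurable fun p : State n d × (Fin n → Ξ) => p.1.gl i + β' •
      clip τ ((1 - β) • p.1.v i + β • G i (p.1.x - γ • p.1.g) (p.2 i) - p.1.gl i) := by fun_prop
  exact measurable_state_iff.2 (hx.prodMk (hg.prodMk
    ((measurable_pi_lambda _ hv).prodMk (measurable_pi_lambda _ hgl))))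

variable [MeasurableSpace Ω] {ξ : ℕ → Fin n → Ω → Ξ} {t : ℕ}

theorem measurable_run (hG : ∀ i, Measurable fun p : E d × Ξ => G i p.1 p.2)
    (hξ : ∀ r ≤ t, ∀ i, Measurable (ξ r i)) :
    Measurable fun ω => run γ β β' τ G x0 (fun r i => ξ r i ω) t := by
  induction t with
  | zero => exact measurable_const
  | succ t ih =>
    exact (measurable_step hG).comp ((ih fun r hr => hξ r (hr.trans t.le_succ)).prodMk
      (measurable_pi_lambda _ (hξ (t + 1) le_rfl)))

theorem measurable_run_succ_x (hG : ∀ i, Measurable fun p : E d × Ξ => G i p.1 p.2)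
    (hξ : ∀ r ≤ t, ∀ i, Measurable (ξ r i)) :
    Measurable fun ω => (run γ β β' τ G x0 (fun r i => ξ r i ω) (t + 1)).x := by
  have hrun : Measurable fun ω => run γ β β' τ G x0 (fun r i => ξ r i ω) t := measurable_run hG hξ
  exact (State.measurable_x.comp hrun).sub ((State.measurable_g.comp hrun).const_smul γ)

theorem measurable_noise {f : Fin n → E d → ℝ} (hf : ∀ i, Measurable (gradient (f i)))
    (hG : ∀ i, Measurable fun p : E d × Ξ => G i p.1 p.2)
    (hξ : ∀ r ≤ t, ∀ i, Measurable (ξ r i)) (i : Fin n) :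
    Measurable fun ω => noise f γ β β' τ G x0 (fun r i => ξ r i ω) t i := by
  have hx : Measurable fun ω => (run γ β β' τ G x0 (fun r i => ξ r i ω) t).x :=
    State.measurable_x.comp (measurable_run hG hξ)
  exact ((hG i).comp (hx.prodMk (hξ t le_rfl i))).sub ((hf i).comp hx)

end Measurability

section Independence

variable {n : ℕ} {Ξ Ω : Type*} [MeasurableSpace Ξ] [mΩ : MeasurableSpace Ω] {P : Measure Ω}
  {D : Fin n → Measure Ξ} {ξ : ℕ → Fin n → Ω → Ξ}

-- Quantifying over the σ-algebra in `hH` says that `H` depends on the samples up to time `t` only.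
theorem IndepSamples.indepFun_succ (hξ : IndepSamples P D ξ) {Y : Type*} [MeasurableSpace Y]
    {H : Ω → Y} {t : ℕ}
    (hH : ∀ _ : MeasurableSpace Ω, (∀ r ≤ t, ∀ i, Measurable (ξ r i)) → Measurable H) :
    IndepFun H (fun ω i => ξ (t + 1) i ω) P := by
  let comapOf (p : ℕ × Fin n) : MeasurableSpace Ω := .comap (ξ p.1 p.2) inferInstance
  have hindep : Indep (⨆ p ∈ {p : ℕ × Fin n | p.1 ≤ t}, comapOf p)
      (⨆ p ∈ {p : ℕ × Fin n | p.1 = t + 1}, comapOf p) P :=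
    indep_iSup_of_disjoint (m := comapOf) (fun p => (hξ.measurable p.1 p.2).comap_le)
      hξ.indep.iIndep
      (Set.disjoint_left.2 fun p (hp : p.1 ≤ t) (hp' : p.1 = t + 1) => by omega)
  have hmeas : ∀ (A : Set (ℕ × Fin n)), ∀ p ∈ A,
      Measurable[⨆ p ∈ A, comapOf p] (ξ p.1 p.2) := fun A p hp =>
    measurable_iff_comap_le.2 (le_iSup₂ (f := fun p (_ : p ∈ A) => comapOf p) p hp)
  rw [IndepFun_iff_Indep]
  refine indep_of_indep_of_le_left (indep_of_indep_of_le_right hindep ?_)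
    (hH _ fun r hr i => hmeas {p | p.1 ≤ t} (r, i) hr).comap_le
  exact measurable_iff_comap_le.1
    (@measurable_pi_lambda _ _ _ (_) _ _ fun i => hmeas {p | p.1 = t + 1} (t + 1, i) rfl)

theorem IndepSamples.isProbabilityMeasure [IsProbabilityMeasure P] (hξ : IndepSamples P D ξ)
    (i : Fin n) : IsProbabilityMeasure (D i) :=
  hξ.law 0 i ▸ Measure.isProbabilityMeasure_map (hξ.measurable 0 i).aemeasurable

theorem IndepSamples.map_eq_pi [IsProbabilityMeasure P] (hξ : IndepSamples P D ξ) (t : ℕ) :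
    P.map (fun ω i => ξ t i ω) = Measure.pi D := by
  have hindep : iIndepFun (fun i => ξ t i) P :=
    hξ.indep.precomp (g := fun i : Fin n => (t, i)) fun i j h => by simpa using h
  rw [(iIndepFun_iff_map_fun_eq_pi_map fun i => (hξ.measurable t i).aemeasurable).1 hindep]
  simp only [hξ.law]

end Independence

section Concentration

variable {n d : ℕ} {Ξ Ω : Type*} [MeasurableSpace Ξ] [MeasurableSpace Ω] {D : Fin n → Measure Ξ}
  {f : Fin n → E d → ℝ} {G : Fin n → E d → Ξ → E d} {σ : ℝ}

theorem SubGaussianOracle.hasSubgaussianNorm (hG : SubGaussianOracle σ f D G) (hσ : 0 ≤ σ)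
    (i : Fin n) [IsProbabilityMeasure (D i)] (x : E d) :
    HasSubgaussianNorm (fun s => G i x s - gradient (f i) x) (8 * σ ^ 2) (D i) := by
  rcases hσ.eq_or_lt with rfl | hσ
  · simpa using hasSubgaussianNorm_zero_of_ae_eq_zero
      ((hG.noiseless rfl i x).mono fun s hs => sub_eq_zero.2 hs)
  · refine hasSubgaussianNorm_of_lintegral_le ((hG.integrable i x).sub (integrable_const _)) ?_ hσ
      (hG.subGaussian i x)
    rw [integral_sub' (hG.integrable i x) (integrable_const _), hG.unbiased i x]
    simp

variable {P : Measure Ω} [IsProbabilityMeasure P] {ξ : ℕ → Fin n → Ω → Ξ} {γ β β' τ b : ℝ}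
  {x0 : E d}

theorem hasSubgaussianNorm_movingAvg_noise (hσ : 0 ≤ σ) (hf : ∀ i, Measurable (gradient (f i)))
    (hG : SubGaussianOracle σ f D G) (hξ : IndepSamples P D ξ) (hb : 0 ≤ b) (hb1 : b ≤ 1)
    (w : Fin n → ℝ) (t : ℕ) :
    HasSubgaussianNorm
      (fun ω => movingAvg b
        (fun r => ∑ i, w i • noise f γ β β' τ G x0 (fun r i => ξ r i ω) r i) t)
      (b * ∑ i, w i ^ 2 * (8 * σ ^ 2)) P := by
  have hD := hξ.isProbabilityMeasure
  have hGm := hG.measurable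
  have hXm : Measurable fun p : E d × (Fin n → Ξ) =>
      ∑ i, w i • (G i p.1 (p.2 i) - gradient (f i) p.1) := by fun_prop
  have hx : ∀ r, Measurable fun ω => (run γ β β' τ G x0 (fun r i => ξ r i ω) r).x := fun r =>
    State.measurable_x.comp (measurable_run hGm fun p _ i => hξ.measurable p i)
  have hζ : ∀ r, Measurable fun ω i => ξ r i ω := fun r => measurable_pi_lambda _ (hξ.measurable r)
  have hX : ∀ r x, HasSubgaussianNorm (fun z => ∑ i, w i • (G i x (z i) - gradient (f i) x))
      (∑ i, w i ^ 2 * (8 * σ ^ 2)) (P.map fun ω i => ξ r i ω) := fun r x => by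
    rw [hξ.map_eq_pi]
    exact HasSubgaussianNorm.sum_pi (X := fun i s => w i • (G i x s - gradient (f i) x))
      (fun i => (hG.hasSubgaussianNorm hσ i x).smul (w i)) (by fun_prop)
  have hind : ∀ r, IndepFun (fun ω => (movingAvg b (fun q => ∑ i, w i •
      noise f γ β β' τ G x0 (fun q i => ξ q i ω) q i) r,
      (run γ β β' τ G x0 (fun q i => ξ q i ω) (r + 1)).x)) (fun ω i => ξ (r + 1) i ω) P := fun r =>
    hξ.indepFun_succ fun _ hm => (measurable_movingAvg fun q hq =>
      Finset.measurable_sum _ fun i _ =>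
        (measurable_noise hf hGm (fun p hp => hm p (hp.trans hq)) i).const_smul (w i)).prodMk
        (measurable_run_succ_x hGm hm)
  unfold noise at hind ⊢
  exact hasSubgaussianNorm_movingAvg (ζ := fun r ω i => ξ r i ω)
    (H := fun r ω => (run γ β β' τ G x0 (fun r i => ξ r i ω) r).x)
    (X := fun x z => ∑ i, w i • (G i x (z i) - gradient (f i) x)) hb hb1 hx hζ hind hX hXm t

theorem measure_lt_norm_sq_movingAvg_noise_le (hσ : 0 ≤ σ)
    (hf : ∀ i, Measurable (gradient (f i))) (hG : SubGaussianOracle σ f D G)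
    (hξ : IndepSamples P D ξ) (hb : 0 ≤ b) (hb1 : b ≤ 1) (w : Fin n → ℝ) (t : ℕ) (ι : ℝ) :
    P {ω | 2 * (b * ∑ i, w i ^ 2 * (8 * σ ^ 2)) * ι < ‖movingAvg b
      (fun r => ∑ i, w i • noise f γ β β' τ G x0 (fun r i => ξ r i ω) r i) t‖ ^ 2}
      ≤ eexp (1 - ι) :=
  (hasSubgaussianNorm_movingAvg_noise hσ hf hG hξ hb hb1 w t).measure_lt_norm_sq_le
    (measurable_movingAvg fun _ _ => Finset.measurable_sum _ fun i _ =>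
      (measurable_noise hf hG.measurable (fun p _ => hξ.measurable p) i).const_smul
        (w i)).aestronglyMeasurable ι

theorem measure_lt_norm_sq_movingAvg_worker_le (hσ : 0 ≤ σ)
    (hf : ∀ i, Measurable (gradient (f i))) (hG : SubGaussianOracle σ f D G)
    (hξ : IndepSamples P D ξ) (hb : 0 ≤ b) (hb1 : b ≤ 1) (i : Fin n) (t : ℕ) (ι : ℝ) :
    P {ω | 16 * b * σ ^ 2 * ι < ‖movingAvg b
      (fun r => noise f γ β β' τ G x0 (fun r i => ξ r i ω) r i) t‖ ^ 2} ≤ eexp (1 - ι) := by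
  have h := measure_lt_norm_sq_movingAvg_noise_le (γ := γ) (β := β) (β' := β') (τ := τ) (x0 := x0)
    hσ hf hG hξ hb hb1 (Pi.single i 1) t ι
  have hproxy : 2 * (b * ∑ j, (Pi.single i 1 : Fin n → ℝ) j ^ 2 * (8 * σ ^ 2)) * ι
      = 16 * b * σ ^ 2 * ι := by
    simp only [Pi.single_apply, ite_pow, one_pow, ne_eq, OfNat.ofNat_ne_zero, not_false_eq_true,
      zero_pow, ite_mul, one_mul, zero_mul, Finset.sum_ite_eq', Finset.mem_univ, if_true]
    ring
  rw [hproxy] at h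
  simpa only [Pi.single_apply, ite_smul, one_smul, zero_smul, Finset.sum_ite_eq',
    Finset.mem_univ, if_true] using h

theorem measure_lt_norm_sq_noise_le (hσ : 0 ≤ σ) (hf : ∀ i, Measurable (gradient (f i)))
    (hG : SubGaussianOracle σ f D G) (hξ : IndepSamples P D ξ) (i : Fin n) (t : ℕ) (ι : ℝ) :
    P {ω | 16 * σ ^ 2 * ι < ‖noise f γ β β' τ G x0 (fun r i => ξ r i ω) (t + 1) i‖ ^ 2}
      ≤ eexp (1 - ι) := by
  simpa only [movingAvg, sub_self, zero_smul, one_smul, zero_add, mul_one] using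
    measure_lt_norm_sq_movingAvg_worker_le (γ := γ) (β := β) (β' := β') (τ := τ) (x0 := x0)
      hσ hf hG hξ zero_le_one le_rfl i (t + 1) ι

theorem measure_lt_norm_sq_movingAvg_mean_le (hσ : 0 ≤ σ)
    (hf : ∀ i, Measurable (gradient (f i))) (hG : SubGaussianOracle σ f D G)
    (hξ : IndepSamples P D ξ) (hb : 0 ≤ b) (hb1 : b ≤ 1) (t : ℕ) (ι : ℝ) :
    P {ω | 16 * b * (σ ^ 2 / n) * ι < ‖movingAvg b
      (fun r => mean (noise f γ β β' τ G x0 (fun r i => ξ r i ω) r)) t‖ ^ 2} ≤ eexp (1 - ι) := by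
  have h := measure_lt_norm_sq_movingAvg_noise_le (γ := γ) (β := β) (β' := β') (τ := τ) (x0 := x0)
    hσ hf hG hξ hb hb1 (fun _ => 1 / (n : ℝ)) t ι
  have hproxy : 2 * (b * ∑ _i : Fin n, (1 / (n : ℝ)) ^ 2 * (8 * σ ^ 2)) * ι
      = 16 * b * (σ ^ 2 / n) * ι := by
    rw [Finset.sum_const, Finset.card_univ, Fintype.card_fin, nsmul_eq_mul]
    field_simp
    ring
  simpa only [hproxy, mean, Finset.smul_sum] using h

theorem measure_exists_mem_le {κ : Type*} {μ : Measure Ω} {I : Finset κ} {p : κ → Ω → Prop}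
    {c : ENNReal} (h : ∀ i ∈ I, μ {ω | p i ω} ≤ c) : μ {ω | ∃ i ∈ I, p i ω} ≤ I.card * c := by
  have hUnion : {ω | ∃ i ∈ I, p i ω} = ⋃ i ∈ I, {ω | p i ω} := by
    ext ω
    simp
  calc μ {ω | ∃ i ∈ I, p i ω} ≤ ∑ i ∈ I, μ {ω | p i ω} := hUnion ▸ measure_biUnion_finset_le _ _
    _ ≤ ∑ _i ∈ I, c := Finset.sum_le_sum h
    _ = I.card * c := by rw [Finset.sum_const, nsmul_eq_mul]

theorem measure_not_noiseBounds_le (hn : 1 ≤ n) (hσ : 0 ≤ σ)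
    (hf : ∀ i, Measurable (gradient (f i))) (hG : SubGaussianOracle σ f D G)
    (hξ : IndepSamples P D ξ) (hβ : 0 ≤ β) (hβ1 : β ≤ 1) (T : ℕ) (ι : ℝ) :
    P {ω | ¬ NoiseBounds (noise f γ β β' τ G x0 (fun r i => ξ r i ω)) β σ ι T}
      ≤ (3 * n * T : ℕ) * eexp (1 - ι) := by
  let ε (ω : Ω) : ℕ → Fin n → E d := noise f γ β β' τ G x0 fun r i => ξ r i ω
  let J : Finset (ℕ × Fin n) := Finset.range T ×ˢ Finset.univ
  let Bad₁ : Set Ω := {ω | ∃ p ∈ J, 16 * σ ^ 2 * ι < ‖ε ω (p.1 + 1) p.2‖ ^ 2}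
  let Bad₂ : Set Ω :=
    {ω | ∃ p ∈ J, 16 * β * σ ^ 2 * ι < ‖movingAvg β (fun r => ε ω r p.2) p.1‖ ^ 2}
  let Bad₃ : Set Ω := {ω | ∃ t ∈ Finset.range T,
    16 * β * (σ ^ 2 / n) * ι < ‖movingAvg β (fun r => mean (ε ω r)) t‖ ^ 2}
  have h₁ : P Bad₁ ≤ J.card * eexp (1 - ι) :=
    measure_exists_mem_le fun p _ => measure_lt_norm_sq_noise_le hσ hf hG hξ p.2 p.1 ι
  have h₂ : P Bad₂ ≤ J.card * eexp (1 - ι) := measure_exists_mem_le fun p _ =>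
    measure_lt_norm_sq_movingAvg_worker_le hσ hf hG hξ hβ hβ1 p.2 p.1 ι
  have h₃ : P Bad₃ ≤ (Finset.range T).card * eexp (1 - ι) := measure_exists_mem_le fun t _ =>
    measure_lt_norm_sq_movingAvg_mean_le hσ hf hG hξ hβ hβ1 t ι
  have hsub : {ω | ¬ NoiseBounds (ε ω) β σ ι T} ⊆ Bad₁ ∪ Bad₂ ∪ Bad₃ := by
    refine fun ω => not_imp_comm.1 fun hω => ?_
    simp only [Bad₁, Bad₂, Bad₃, J, Set.mem_union, Set.mem_ofPred_eq, Finset.mem_product,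
      Finset.mem_range, Finset.mem_univ, and_true, Prod.exists, not_or, not_exists, not_and,
      not_lt] at hω
    exact ⟨fun t ht i => hω.1.1 t i ht, fun t ht i => hω.1.2 t i ht, hω.2⟩
  have hcard : J.card + J.card + (Finset.range T).card ≤ 3 * n * T := by
    simp only [J, Finset.card_product, Finset.card_univ, Fintype.card_fin, Finset.card_range]
    nlinarith
  calc P {ω | ¬ NoiseBounds (ε ω) β σ ι T} ≤ P Bad₁ + P Bad₂ + P Bad₃ :=
        (measure_mono hsub).trans ((measure_union_le _ _).trans
          (add_le_add_left (measure_union_le _ _) _))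
    _ ≤ (J.card + J.card + (Finset.range T).card : ℕ) * eexp (1 - ι) := by
        push_cast
        rw [add_mul, add_mul]
        gcongr
    _ ≤ (3 * n * T : ℕ) * eexp (1 - ι) := by gcongr

theorem ofReal_one_sub_le_of_compl_subset {α : ℝ} (hα : 0 ≤ α) {A N : Set Ω} (hA : Aᶜ ⊆ N)
    (hN : P N ≤ ENNReal.ofReal α) : ENNReal.ofReal (1 - α) ≤ P A := by
  rw [ENNReal.ofReal_sub _ hα, ENNReal.ofReal_one, tsub_le_iff_right]
  calc (1 : ENNReal) = P (A ∪ N) := by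
        rw [Set.compl_subset_iff_union.1 hA, measure_univ]
    _ ≤ P A + ENNReal.ofReal α := (measure_union_le _ _).trans (by gcongr)

end Concentration

/-! ### Choice of the parameters -/

section Parameters

theorem mul_eexp_one_sub_log_le {n T : ℕ} {α : ℝ} (hn : 1 ≤ n) (hα : 0 < α) :
    ((3 * n * T : ℕ) : ENNReal) * eexp (1 - Real.log (12 * n * (T + 1) / α))
      ≤ ENNReal.ofReal α := by
  have : (0 : ℝ) < n := by exact_mod_cast hn
  have hT : (T : ℝ) / (T + 1) ≤ 1 := (div_le_one (by positivity)).2 (by linarith)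
  rw [eexp, ← ENNReal.ofReal_natCast, ← ENNReal.ofReal_mul (by positivity)]
  refine ENNReal.ofReal_le_ofReal ?_
  rw [Real.exp_sub, Real.exp_log (by positivity)]
  calc ((3 * n * T : ℕ) : ℝ) * (Real.exp 1 / (12 * n * (T + 1) / α))
      ≤ ((3 * n * T : ℕ) : ℝ) * (3 / (12 * n * (T + 1) / α)) := by
        gcongr
        exact Real.exp_one_lt_three.le
    _ = 3 / 4 * (T / (T + 1)) * α := by
        push_cast
        field_simp
        ring
    _ ≤ 1 * α := by
        gcongr
        linarith
    _ = α := one_mul α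

theorem one_le_log {n T : ℕ} {α : ℝ} (hn : 1 ≤ n) (hα : 0 < α) (hα1 : α < 1) :
    1 ≤ Real.log (12 * n * (T + 1) / α) := by
  have hn1 : (1 : ℝ) ≤ n := by exact_mod_cast hn
  have : (0 : ℝ) ≤ T := T.cast_nonneg
  rw [Real.le_log_iff_exp_le (by positivity), le_div_iff₀ hα]
  calc Real.exp 1 * α ≤ 3 * 1 := by
        gcongr
        exact Real.exp_one_lt_three.le
    _ ≤ 12 * n * (T + 1) := by nlinarith

/-- The inverse of the momentum parameter. The second summand prevents clipping, the third one
balances the noise against the initial gap `Δ`. -/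
noncomputable def invMomentum (n T : ℕ) (L Δ B τ σ q ι : ℝ) : ℝ :=
  1 + 8 * ι * (σ + B + √(L * Δ)) / (q * τ) + σ * √T / √(n * (L * Δ))

variable {n T : ℕ} {L Δ B τ σ q ι : ℝ}

theorem isTuned_inv_invMomentum (hn : 1 ≤ n) (hL : 0 < L) (hΔ : 0 < Δ) (hB : 0 ≤ B) (hτ : 0 < τ)
    (hσ : 0 ≤ σ) (hq : 0 < q) (hι : 0 ≤ ι) :
    IsTuned n T L Δ B τ σ q ι (q ^ 2 / (108 * L) * (invMomentum n T L Δ B τ σ q ι)⁻¹)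
      (invMomentum n T L Δ B τ σ q ι)⁻¹ := by
  have : (0 : ℝ) < n := by exact_mod_cast hn
  have hinv : invMomentum n T L Δ B τ σ q ι
      = 1 + 8 * ι * (σ + B + √(L * Δ)) / (q * τ) + σ * √T / √(n * (L * Δ)) := rfl
  set X := 8 * ι * (σ + B + √(L * Δ)) / (q * τ) with hX
  set Y := σ * √T / √(n * (L * Δ)) with hY
  have hX0 : 0 ≤ X := by positivity
  have hY0 : 0 ≤ Y := by positivity
  rw [hinv]
  set Z := 1 + X + Y
  have hZ0 : 0 < Z := by positivity
  have hXZ : Z⁻¹ * X ≤ 1 := by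
    rw [inv_mul_le_one₀ hZ0]
    linarith
  have hYZ : Z⁻¹ * Y ≤ 1 := by
    rw [inv_mul_le_one₀ hZ0]
    linarith
  refine ⟨by positivity, by positivity, inv_le_one_of_one_le₀ (by linarith), ?_, ?_, ?_⟩
  · exact le_of_eq (by field_simp)
  · calc Z⁻¹ ^ 2 * T * σ ^ 2 = (Z⁻¹ * Y) ^ 2 * (n * (L * Δ)) := by
          rw [hY, mul_pow, div_pow, mul_pow, Real.sq_sqrt T.cast_nonneg,
            Real.sq_sqrt (by positivity)]
          field_simp
      _ ≤ n * (L * Δ) := mul_le_of_le_one_left (by positivity) (pow_le_one₀ (by positivity) hYZ)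
  · calc 8 * Z⁻¹ * ι * (σ + B + √(L * Δ)) = Z⁻¹ * X * (q * τ) := by
          rw [hX]
          field_simp
      _ ≤ q * τ := mul_le_of_le_one_left (by positivity) hXZ

theorem add_le_mainRate_add_higherOrder (hB : 0 ≤ B) (hτ : 0 < τ) (hσ : 0 ≤ σ) :
    L * Δ / T + L * Δ * (σ + B + √(L * Δ)) / (τ * T) + σ * √(L * Δ) / √(n * T)
      ≤ mainRate n T L Δ B τ σ + higherOrder T L Δ τ σ := by
  have hsplit : mainRate n T L Δ B τ σ + higherOrder T L Δ τ σ
      = L * Δ / T + L * Δ * (σ + B + √(L * Δ)) / (τ * T) + σ * √(L * Δ) / √(n * T)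
        + σ * (B + σ) / √(n * T) := by
    rw [mainRate, higherOrder]
    field_simp
    ring
  rw [hsplit]
  exact le_add_of_nonneg_right (by positivity)

theorem mul_invMomentum_le (hn : 1 ≤ n) (hT : 1 ≤ T) (hL : 0 < L) (hΔ : 0 < Δ)
    (hB : 0 ≤ B) (hτ : 0 < τ) (hσ : 0 ≤ σ) (hq : 0 < q) (hq1 : q ≤ 1) (hι : 1 ≤ ι) :
    864 * ι / q ^ 2 * (L * Δ / T * invMomentum n T L Δ B τ σ q ι)
      ≤ 6912 / q ^ 3 * ι ^ 2 * (mainRate n T L Δ B τ σ + higherOrder T L Δ τ σ) := by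
  have hn0 : (0 : ℝ) < n := by exact_mod_cast hn
  have hT0 : (0 : ℝ) < T := by exact_mod_cast hT
  have hqι : q ≤ 8 * ι := by linarith
  have hnoise : L * Δ / T * (σ * √T / √(n * (L * Δ))) = σ * √(L * Δ) / √(n * T) := by
    rw [Real.sqrt_mul hn0.le, Real.sqrt_mul hn0.le, ← Real.mul_self_sqrt hT0.le,
      Real.sqrt_mul_self (Real.sqrt_nonneg _)]
    nth_rw 1 [← Real.mul_self_sqrt (by positivity : 0 ≤ L * Δ)]
    field_simp
  calc 864 * ι / q ^ 2 * (L * Δ / T * invMomentum n T L Δ B τ σ q ι)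
      = 864 * ι / q ^ 3 * (q * (L * Δ / T)
          + 8 * ι * (L * Δ * (σ + B + √(L * Δ)) / (τ * T)) + q * (σ * √(L * Δ) / √(n * T))) := by
        rw [invMomentum, mul_add (L * Δ / T), hnoise]
        field_simp
    _ ≤ 864 * ι / q ^ 3 * (8 * ι * (L * Δ / T)
          + 8 * ι * (L * Δ * (σ + B + √(L * Δ)) / (τ * T))
          + 8 * ι * (σ * √(L * Δ) / √(n * T))) := by gcongr
    _ = 6912 / q ^ 3 * ι ^ 2 * (L * Δ / T + L * Δ * (σ + B + √(L * Δ)) / (τ * T)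
          + σ * √(L * Δ) / √(n * T)) := by ring
    _ ≤ 6912 / q ^ 3 * ι ^ 2 * (mainRate n T L Δ B τ σ + higherOrder T L Δ τ σ) := by
        gcongr 6912 / q ^ 3 * ι ^ 2 * ?_
        exact add_le_mainRate_add_higherOrder hB hτ hσ

theorem exists_isTuned (hn : 1 ≤ n) (hT : 1 ≤ T) (hL : 0 < L) (hΔ : 0 < Δ) (hB : 0 ≤ B)
    (hτ : 0 < τ) (hσ : 0 ≤ σ) (hq : 0 < q) (hq1 : q ≤ 1) (hι : 1 ≤ ι) :
    ∃ γ β, IsTuned n T L Δ B τ σ q ι γ β ∧ 8 * ι * Δ / (γ * T)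
      ≤ 6912 / q ^ 3 * ι ^ 2 * (mainRate n T L Δ B τ σ + higherOrder T L Δ τ σ) := by
  have hP := isTuned_inv_invMomentum (T := T) hn hL hΔ hB hτ hσ hq (zero_le_one.trans hι)
  refine ⟨_, _, hP, le_of_eq_of_le ?_ (mul_invMomentum_le hn hT hL hΔ hB hτ hσ hq hq1 hι)⟩
  have hinv := inv_pos.1 hP.momentum_pos
  have : (0 : ℝ) < T := by exact_mod_cast hT
  field_simp
  norm_num

end Parameters

theorem avgSqGrad_le {n d T : ℕ} {Ξ : Type*} {f : Fin n → E d → ℝ} {L Δ B τ σ q ι γ β : ℝ}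
    {G : Fin n → E d → Ξ → E d} {x0 : E d} {s : ℕ → Fin n → Ξ}
    (hP : IsTuned n T L Δ B τ σ q ι γ β) (hN : NoiseBounds (noise f γ β q τ G x0 s) β σ ι T)
    (hn : 1 ≤ n) (hT : 1 ≤ T) (hf : SmoothProblem L f) (hL : 0 < L)
    (hΔ : avgLoss f x0 - (⨅ x, avgLoss f x) ≤ Δ) (hB : ∀ i, ‖gradient (f i) x0‖ ≤ B)
    (hσ : 0 ≤ σ) (hq : 0 < q) (hq1 : q ≤ 1) (hι : 1 ≤ ι) (hτ : 0 ≤ τ) :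
    avgSqGrad f γ β q τ G x0 s T ≤ 8 * ι * Δ / (γ * T) := by
  have hsum := (isNoisyRun_run f γ β q τ G x0 s).sum_norm_gradient_sq_le hP hN hn hT hf hL hΔ hB
    hσ hq hq1 hι hτ
  have hγ := hP.step_pos
  have hT0 : (0 : ℝ) < T := by exact_mod_cast hT
  rw [avgSqGrad, one_div_mul_eq_div, div_le_div_iff₀ hT0 (by positivity)]
  have hscaled := mul_le_mul_of_nonneg_right hsum hT0.le
  linarith

end Clip21

theorem theorem3 :
    -- `k` is the power of the logarithm; `C` depends on the momentum parameter `β'` only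
    ∃ k : ℕ, ∀ β' : ℝ, 0 < β' → β' ≤ 1 → ∃ C : ℝ, 0 < C ∧
      ∀ (n T : ℕ) (L Δ B τ σ α : ℝ), 1 ≤ n → 1 ≤ T → 0 < L → 0 < Δ → 0 < τ → 0 ≤ σ →
        0 < α → α < 1 →
        ∃ γ β : ℝ, 0 < γ ∧ 0 < β ∧ β ≤ 1 ∧
          ∀ (d : ℕ) (f : Fin n → Clip21.E d → ℝ) (x0 : Clip21.E d),
            Clip21.SmoothProblem L f →
            Clip21.avgLoss f x0 - (⨅ x, Clip21.avgLoss f x) ≤ Δ →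
            B = (⨆ i, ‖gradient (f i) x0‖) →
            ∀ (Ξ Ω : Type*) [MeasurableSpace Ξ] [MeasurableSpace Ω] (P : Measure Ω)
              [IsProbabilityMeasure P] (D : Fin n → Measure Ξ)
              (G : Fin n → Clip21.E d → Ξ → Clip21.E d) (ξ : ℕ → Fin n → Ω → Ξ),
              Clip21.SubGaussianOracle σ f D G →
              Clip21.IndepSamples P D ξ →
              ENNReal.ofReal (1 - α) ≤
                P {ω | Clip21.avgSqGrad f γ β β' τ G x0 (fun t i => ξ t i ω) T ≤
                  C * Real.log (12 * n * (T + 1) / α) ^ k *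
                    (Clip21.mainRate n T L Δ B τ σ + Clip21.higherOrder T L Δ τ σ)} := by
  refine ⟨2, fun q hq hq1 => ⟨6912 / q ^ 3, by positivity, ?_⟩⟩
  intro n T L Δ B τ σ α hn hT hL hΔ hτ hσ hα hα1
  have hι := Clip21.one_le_log (T := T) hn hα hα1
  set ι := Real.log (12 * n * (T + 1) / α)
  -- `B` enters through its absolute value since `0 ≤ B` is known only once the problem is given.
  obtain ⟨γ, β, hP, hrate⟩ :=
    Clip21.exists_isTuned hn hT hL hΔ (abs_nonneg B) hτ hσ hq hq1 hι
  refine ⟨γ, β, hP.step_pos, hP.momentum_pos, hP.momentum_le_one, ?_⟩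
  intro d f x0 hf hgap hB Ξ Ω _ _ P _ D G ξ hG hξ
  rw [abs_of_nonneg (hB ▸ Real.iSup_nonneg fun i => norm_nonneg _)] at hP hrate
  have hBi : ∀ i, ‖gradient (f i) x0‖ ≤ B := fun i =>
    hB ▸ le_ciSup (Set.finite_range fun i => ‖gradient (f i) x0‖).bddAbove i
  have hbad := (Clip21.measure_not_noiseBounds_le (γ := γ) (β' := q) (τ := τ) (x0 := x0) hn hσ
    (fun i => (hf.smoothWith i).measurable_gradient) hG hξ hP.momentum_pos.le hP.momentum_le_one
    T ι).trans (Clip21.mul_eexp_one_sub_log_le hn hα)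
  refine Clip21.ofReal_one_sub_le_of_compl_subset hα.le ?_ hbad
  exact fun ω hω hN => hω <|
    (Clip21.avgSqGrad_le hP hN hn hT hf hL hgap hBi hσ hq hq1 hι hτ.le).trans hrate
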